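/- Model. A transformer acts on sequences of $N\ge 0$ tokens, each carrying a residual stream in $\mathbb R^D$ with constant width $D$. A layer is an attention sublayer followed by a feedforward sublayer. Each sublayer first applies multi-pre-norm (finitely many linear projections of the residual stream, each mapped to $y'/\lVert y'\rVert$ with $y'=y-\mathrm{mean}(y)$, then concatenated), and its output is added to the residual stream. Attention has finitely many heads with dot-product scores, each head being unmasked or strictly causally masked, and takes the uniform average of the values at the visible positions of maximal score ($0$ if no position is visible). A feedforward network is a nesting of maps $z\mapsto U\,\mathrm{ReLU}(Wz)$. In $p$-precision arithmetic, all parameters and the results of all these operations are rounded to the nearest multiple of $2^{-p}$ and clipped to $[-2^p,2^p]$. A looped transformer has fixed blocks of layers $\langle A,B,C\rangle$; on $N$ tokens it applies $A$, then $B$ repeated $t(N)$ times, then $C$, in $p(N)$-precision arithmetic. It is $O(\log n)$-looped if $t(n)=O(\log n)$ and has log-precision if $p(n)=O(\log n)$. Layout. Let $\psi$ be a variable-free Boolean formula built from the truth values $\mathrm T,\mathrm F$ with the binary connectives $\land,\lor$, and let $\mathcal G_\psi$ be its binary expression tree. Residual streams $x_0,\dots,x_{N-1}$ in $\mathbb R^{6+k}$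 represent $\psi$ if distinct nodes of $\mathcal G_\psi$ are assigned distinct tokens such that the token of each leaf encodes its value ($\mathrm T$ or $\mathrm F$), and the token of each function node encodes its type ($\land$ or $\lor$) and pointers to its two arguments, i.e. the positions in $\{0,\dots,N-1\}$ of the tokens of its two children. Here value and type are encoded by four one-hot coordinates and each pointer by one coordinate that holds the position as a number; pointer coordinates of leaves, the $k$ other coordinates, and tokens assigned to no node are arbitrary. Lemma. For every $k$ and every $q(n)=O(\log n)$ there are a number $e$ of additional coordinates, a vector $u\in\mathbb R^e$, a distinguished additional coordinate, and an $O(\log n)$-looped, log-precision averaging-hard-attention transformer of width $6+k+e$ such that the following holds for all $N$, all variable-free Boolean formulas $\psi$ over $\land,\lor$, and all residual streams $x_0,\dots,x_{N-1}\in\mathbb R^{6+k}$ that represent $\psi$ and whose entries are exactly representable in $q(N)$-precision arithmetic. Run on the $N$ tokens, with the additional coordinates of every token initialised to (the rounding of) $u$, the transformer leaves all $6+k$ original coordinates of all tokens unchanged at the end of the pass, and for every subformula of $\psi$ (every node of $\mathcal G_\psi$) the distinguished coordinate of its token equals $1$ if the subformula evaluates to $\mathrm T$ and $0$ if it evaluates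 to $\mathrm F$. -/

import Mathlib

open Asymptotics Filter

noncomputable section

/-! ## Variable-free Boolean formulas and their expression trees -/

/-- The two binary connectives. -/
inductive BoolOp : Type
  | and
  | or
deriving DecidableEq

/-- The truth function of a connective. -/
def BoolOp.apply : BoolOp → Bool → Bool → Bool
  | .and, a, b => a && b
  | .or, a, b => a || b

/-- Variable-free Boolean formulas, which are the same thing as their binary expression trees:
leaves carry a truth value, function nodes carry a connective and have two children. -/
inductive BoolFormula : Type
  | leaf (b : Bool) : BoolFormula
  | gate (o : BoolOp) (l r : BoolFormula) : BoolFormula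

namespace BoolFormula

/-- The truth value of a formula. -/
def eval : BoolFormula → Bool
  | leaf b => b
  | gate o l r => o.apply l.eval r.eval

/-- The subformula found by following a path down from the root
(`false` = first argument, `true` = second argument), if the path stays inside the tree. -/
def subAt : BoolFormula → List Bool → Option BoolFormula
  | φ, [] => some φ
  | leaf _, _ :: _ => none
  | gate _ l r, b :: π => bif b then r.subAt π else l.subAt π

/-- The nodes of the expression tree, i.e. the occurrences of subformulas, named by their paths
from the root. -/
def nodes (ψ : BoolFormula) : Set (List Bool) :=
  {π | (ψ.subAt π).isSome}

end BoolFormula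

/-! ## Averaging-hard-attention transformers with limited precision -/

namespace AHAT

/-- Arithmetic with `2 p + O(1)` bits: round to the nearest multiple of `2 ^ (-p)` and saturate at
`± 2 ^ p`. -/
def rnd (p : ℕ) (x : ℝ) : ℝ :=
  max (-(2 : ℝ) ^ p) (min ((2 : ℝ) ^ p) ((round (x * 2 ^ p) : ℝ) / 2 ^ p))

/-- The numbers that `p`-precision arithmetic stores exactly. -/
def Representable (p : ℕ) (x : ℝ) : Prop :=
  rnd p x = x

/-- The linear map with matrix `W` in `p`-precision arithmetic: parameters and results are
rounded. -/
def linMap (p : ℕ) {κ ι : Type} [Fintype ι] (W : Matrix κ ι ℝ) (x : ι → ℝ) : κ → ℝ :=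
  fun i => rnd p (∑ j, rnd p (W i j) * x j)

/-- The `j`-th coordinate of the layer-norm of the vector `(y l)`, `l ∈ S`:
subtract the mean, then divide by the Euclidean norm. -/
def layerNorm {κ : Type} (S : Finset κ) (y : κ → ℝ) (j : κ) : ℝ :=
  (y j - (∑ l ∈ S, y l) / S.card) / √(∑ l ∈ S, (y l - (∑ l' ∈ S, y l') / S.card) ^ 2)

/-- Parameters of a multi-pre-norm: the rows of `proj` are grouped into blocks (two rows are in the
same block if they have the same label); every block is a projection of the hidden state. -/
structure PreNorm (ι : Type) where
  dim : ℕ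
  proj : Matrix (Fin dim) ι ℝ
  block : Fin dim → ℕ

/-- Multi-pre-norm: each projection is layer-normalized separately; the results are
concatenated. -/
def PreNorm.eval {ι : Type} [Fintype ι] (p : ℕ) (M : PreNorm ι) (x : ι → ℝ) : Fin M.dim → ℝ :=
  fun j => rnd p
    (layerNorm (Finset.univ.filter fun l => M.block l = M.block j) (linMap p M.proj x) j)

/-- The two kinds of masking: none, and strict causal masking. -/
inductive Mask : Type
  | unmasked
  | strictCausal

/-- The positions to which position `i` may attend. -/
def Mask.visible {N : ℕ} : Mask → Fin N → Finset (Fin N)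
  | .unmasked, _ => Finset.univ
  | .strictCausal, i => Finset.univ.filter fun j => j < i

/-- An attention head: query, key and value matrices, and a mask. -/
structure Head (a : ℕ) (ι : Type) where
  dim : ℕ
  Q : Matrix (Fin dim) (Fin a) ℝ
  K : Matrix (Fin dim) (Fin a) ℝ
  V : Matrix ι (Fin a) ℝ
  mask : Mask

namespace Head

variable {a N : ℕ} {ι : Type}

/-- The dot-product score of the query at `i` and the key at `j`. -/
def score (p : ℕ) (h : Head a ι) (z : Fin N → Fin a → ℝ) (i j : Fin N) : ℝ :=
  rnd p (∑ t, linMap p h.K (z j) t * linMap p h.Q (z i) t)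

/-- The visible positions with maximal score. -/
def argmax (p : ℕ) (h : Head a ι) (z : Fin N → Fin a → ℝ) (i : Fin N) : Finset (Fin N) :=
  open Classical in
  (h.mask.visible i).filter fun j => ∀ l ∈ h.mask.visible i, h.score p z i l ≤ h.score p z i j

/-- Averaging hard attention: the uniform average of the values at the visible positions of
maximal score (zero if no position is visible). -/
def eval (p : ℕ) (h : Head a ι) (z : Fin N → Fin a → ℝ) (i : Fin N) : ι → ℝ :=
  fun c => rnd p ((∑ j ∈ h.argmax p z i, linMap p h.V (z j) c) / (h.argmax p z i).card)

end Head

/-- Feedforward networks: nested functions of the form `z ↦ U (ReLU (W z))`. -/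
inductive FFN (ι : Type) : ℕ → Type
  | last {a : ℕ} (m : ℕ) (W : Matrix (Fin m) (Fin a) ℝ) (U : Matrix ι (Fin m) ℝ) : FFN ι a
  | nest {a : ℕ} (m b : ℕ) (W : Matrix (Fin m) (Fin a) ℝ) (U : Matrix (Fin b) (Fin m) ℝ)
      (f : FFN ι b) : FFN ι a

/-- The function computed by a feedforward network in `p`-precision arithmetic. -/
def FFN.eval (p : ℕ) {ι : Type} : {a : ℕ} → FFN ι a → (Fin a → ℝ) → ι → ℝ
  | _, .last _ W U, z => linMap p U fun t => max 0 (linMap p W z t)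
  | _, .nest _ _ W U f, z => f.eval p (linMap p U fun t => max 0 (linMap p W z t))

/-- A transformer layer: an attention sublayer (with finitely many heads) followed by a feedforward
sublayer, each with its own multi-pre-norm. -/
structure Layer (ι : Type) where
  attNorm : PreNorm ι
  heads : List (Head attNorm.dim ι)
  ffnNorm : PreNorm ι
  ffn : FFN ι ffnNorm.dim

namespace Layer

variable {N : ℕ} {ι : Type} [Fintype ι]

/-- The attention sublayer: the outputs of the heads are added to the residual stream. -/
def attend (p : ℕ) (L : Layer ι) (x : Fin N → ι → ℝ) : Fin N → ι → ℝ :=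
  fun i c =>
    rnd p (x i c + (L.heads.map fun h => h.eval p (fun j => L.attNorm.eval p (x j)) i c).sum)

/-- The feedforward sublayer: the output of the network is added to the residual stream,
position by position. -/
def feed (p : ℕ) (L : Layer ι) (x : Fin N → ι → ℝ) : Fin N → ι → ℝ :=
  fun i c => rnd p (x i c + L.ffn.eval p (L.ffnNorm.eval p (x i)) c)

/-- The action of a layer on the residual streams of `N` tokens. -/
def eval (p : ℕ) (L : Layer ι) (x : Fin N → ι → ℝ) : Fin N → ι → ℝ :=
  L.feed p (L.attend p x)

end Layer

/-- The composition of a block of layers, the first layer of the list being applied first. -/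
def runBlock (p : ℕ) {N : ℕ} {ι : Type} [Fintype ι] (B : List (Layer ι)) (x : Fin N → ι → ℝ) :
    Fin N → ι → ℝ :=
  B.foldl (fun y L => L.eval p y) x

/-- A looped transformer whose residual streams have coordinates `ι`: an initial, a looped and a
final block of layers, none of which depends on the number `n` of tokens; the number of times that
the looped block is repeated on `n` tokens; and the precision of the arithmetic on `n` tokens. -/
structure LoopedTransformer (ι : Type) where
  initial : List (Layer ι)
  looped : List (Layer ι)
  final : List (Layer ι)
  loops : ℕ → ℕ
  prec : ℕ → ℕ

/-- The residual streams at the end of the forward pass on `N` tokens. -/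
def LoopedTransformer.run {N : ℕ} {ι : Type} [Fintype ι] (T : LoopedTransformer ι)
    (x : Fin N → ι → ℝ) : Fin N → ι → ℝ :=
  runBlock (T.prec N) T.final
    ((runBlock (T.prec N) T.looped)^[T.loops N] (runBlock (T.prec N) T.initial x))

/-- A function of the number of tokens that is `O(log n)`. -/
def IsOLog (f : ℕ → ℕ) : Prop :=
  (fun n => (f n : ℝ)) =O[atTop] fun n : ℕ => Real.log n

end AHAT

/-! ## Formulas laid out in residual streams -/

/-- The coordinates of the residual stream that describe a node of an expression tree:
`value b` flags a leaf of value `b`, `gate o` flags a function node of type `o`, and `arg false`,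
`arg true` hold the pointers to the first and second argument. -/
inductive Slot : Type
  | value (b : Bool)
  | gate (o : BoolOp)
  | arg (b : Bool)
deriving DecidableEq

instance : Fintype Slot where
  elems := {.value false, .value true, .gate .and, .gate .or, .arg false, .arg true}
  complete := by
    rintro (b | o | b)
    · cases b <;> decide
    · cases o <;> decide
    · cases b <;> decide

/-- The residual streams `x` of `N` tokens represent the formula `ψ`: distinct nodes `π` are
represented by distinct tokens `tok π`; the token of a leaf encodes its value; the token of a
function node encodes its type and, as pointers, the positions of the tokens of its two arguments.
Nothing is said about the `k` other coordinates, about the pointer coordinates of leaves, or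
about tokens that represent no node. -/
structure Represents {N k : ℕ} (x : Fin N → Slot ⊕ Fin k → ℝ) (ψ : BoolFormula)
    (tok : List Bool → Fin N) : Prop where
  injOn : Set.InjOn tok ψ.nodes
  leaf_value : ∀ π b, ψ.subAt π = some (.leaf b) →
    ∀ b', x (tok π) (.inl (.value b')) = if b' = b then 1 else 0
  leaf_gate : ∀ π b, ψ.subAt π = some (.leaf b) → ∀ o, x (tok π) (.inl (.gate o)) = 0
  gate_value : ∀ π o l r, ψ.subAt π = some (.gate o l r) → ∀ b, x (tok π) (.inl (.value b)) = 0
  gate_type : ∀ π o l r, ψ.subAt π = some (.gate o l r) →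
    ∀ o', x (tok π) (.inl (.gate o')) = if o' = o then 1 else 0
  gate_arg : ∀ π o l r, ψ.subAt π = some (.gate o l r) →
    ∀ b, x (tok π) (.inl (.arg b)) = ((tok (π ++ [b])).val : ℝ)

/-- Allocate additional coordinates in the residual stream of every token, with the same initial
content `u` (rounded to the precision `p`) in all tokens. -/
def allocate {N k e : ℕ} (p : ℕ) (u : Fin e → ℝ) (x : Fin N → Slot ⊕ Fin k → ℝ) :
    Fin N → (Slot ⊕ Fin k) ⊕ Fin e → ℝ :=
  fun i => Sum.elim (x i) fun j => AHAT.rnd p (u j)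

end

/-! Parallel tree contraction evaluates a formula with `n` nodes in `O(log n)` rounds, and one round
is simple enough for a constant number of layers.

Every node keeps what it knows of its value and a pointer to a descendant with the same value, at
first itself. In a round it copies the value of its target or learns its value from an absorbing
argument. If an argument is known to be neutral, a node that has not moved yet points to the other
one; otherwise it replaces its pointer by that of its target. Two neutral arguments need no rule:
the pointer to one of them delivers the value. These rules preserve `Sound`. The speed comes from
`Progress` with parameter `m`: nodes with at most `m` nodes below them are known, and the pointer of
an unknown node has left `m` nodes behind or has reached a node with two arguments of more than `m`
nodes. Then a node of size at most `2 * m` is known after one more round, and three further rounds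
restore the invariant for `2 * m` (`Progress.double`).

In the transformer, position `m` is stored as the direction of `(m, 1)`. Layer-normalizing a vector
together with its negative merely scales it, so dot products compare directions. Those of different
positions below `N` are separated by a gap of order `N ^ (-4)` (`dot_dir_le`), so with
logarithmically many bits hard attention finds exactly the token that a pointer designates
(`HeadSpec.eval_lookup`). A token `i > 0` finds its own direction from `1 / i`, a strictly causal
average. Rounding errors do not accumulate: updates add differences of features in which the old
contents cancel exactly, and each round ends by replacing the pointer with the canonical one
computed by its target (`layerFix_att`). The Boolean rules are lookup tables, exact because bits
normalize to `± 1 / 2` (`tableFFN_eval`). Hence the registers of the nodes follow the contraction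
exactly (`iterate_spec`). -/

noncomputable section

/-! ## Tree contraction -/

namespace BoolFormula

/-- The number of nodes of the expression tree. -/
def size : BoolFormula → ℕ
  | leaf _ => 1
  | gate _ l r => l.size + r.size + 1

/-- The number of nodes below `π` (including `π`), zero if `π` is not a node. -/
def sizeAt (ψ : BoolFormula) (π : List Bool) : ℕ :=
  ((ψ.subAt π).map size).getD 0

theorem subAt_nil (ψ : BoolFormula) : ψ.subAt [] = some ψ := by
  cases ψ <;> rfl

theorem subAt_append (ψ : BoolFormula) (π ρ : List Bool) :
    ψ.subAt (π ++ ρ) = (ψ.subAt π).bind fun φ => φ.subAt ρ := by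
  induction π generalizing ψ with
  | nil => simp [subAt_nil]
  | cons b π ih =>
    cases ψ with
    | leaf c => simp [subAt]
    | gate o l r => cases b <;> simp [subAt, ih]

theorem subAt_child {ψ : BoolFormula} {π : List Bool} {o : BoolOp} {l r : BoolFormula}
    (h : ψ.subAt π = some (gate o l r)) (d : Bool) :
    ψ.subAt (π ++ [d]) = some (bif d then r else l) := by
  rw [subAt_append, h]
  cases d <;> simp [subAt, subAt_nil]

theorem size_subAt_le (ψ : BoolFormula) (π : List Bool) : ψ.sizeAt π ≤ ψ.size := by
  unfold sizeAt
  induction π generalizing ψ with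
  | nil => simp [subAt_nil]
  | cons b π ih =>
    cases ψ with
    | leaf c => simp [subAt]
    | gate o l r =>
      have hl := ih l
      have hr := ih r
      cases b <;> simp only [subAt, size, cond_true, cond_false] <;> omega

theorem sizeAt_append {ψ φ : BoolFormula} {π : List Bool} (h : ψ.subAt π = some φ)
    (ρ : List Bool) : ψ.sizeAt (π ++ ρ) = φ.sizeAt ρ := by
  simp [sizeAt, subAt_append, h]

theorem sizeAt_append_le (ψ : BoolFormula) (π ρ : List Bool) :
    ψ.sizeAt (π ++ ρ) ≤ ψ.sizeAt π := by
  rcases h : ψ.subAt π with _ | φ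
  · simp [sizeAt, subAt_append, h]
  · rw [sizeAt_append h]
    simpa [sizeAt, h] using φ.size_subAt_le ρ

/-- Accounting for a pointer that descends from `π` through the argument `d`: it leaves behind `π`
itself and the whole other argument. Paths outside the tree have size zero, so dead ends need no
exception. -/
theorem sizeAt_append_cons {ψ : BoolFormula} {π : List Bool} (h : π ∈ ψ.nodes) (d : Bool)
    (ρ : List Bool) : ψ.sizeAt (π ++ d :: ρ) + ψ.sizeAt (π ++ [!d]) + 1 ≤ ψ.sizeAt π := by
  obtain ⟨φ, hφ⟩ := Option.isSome_iff_exists.1 h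
  rw [sizeAt_append hφ, sizeAt_append hφ]
  have hs : ψ.sizeAt π = φ.size := by simp [sizeAt, hφ]
  rw [hs]
  cases φ with
  | leaf c => simp [sizeAt, subAt, size]
  | gate o l r =>
    have hl := l.size_subAt_le ρ
    have hr := r.size_subAt_le ρ
    unfold sizeAt at *
    cases d <;> simp [subAt, subAt_nil, size] <;> omega

theorem sizeAt_pos {ψ : BoolFormula} {π : List Bool} : 0 < ψ.sizeAt π ↔ π ∈ ψ.nodes := by
  unfold sizeAt nodes
  rcases h : ψ.subAt π with _ | φ
  · simp [h]
  · cases φ <;> simp [h, size]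

/-- The list of all nodes. -/
def nodeList : BoolFormula → List (List Bool)
  | leaf _ => [[]]
  | gate _ l r => [] :: (l.nodeList.map (List.cons false) ++ r.nodeList.map (List.cons true))

theorem length_nodeList (ψ : BoolFormula) : ψ.nodeList.length = ψ.size := by
  induction ψ with
  | leaf b => rfl
  | gate o l r hl hr => simp [nodeList, size, hl, hr]

theorem nodup_nodeList (ψ : BoolFormula) : ψ.nodeList.Nodup := by
  induction ψ with
  | leaf b => simp [nodeList]
  | gate o l r hl hr =>
    simp only [nodeList, List.nodup_cons, List.nodup_append]
    refine ⟨by simp, hl.map (List.cons_injective), hr.map (List.cons_injective), ?_⟩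
    intro a ha b hb
    simp only [List.mem_map] at ha hb
    obtain ⟨a, -, rfl⟩ := ha
    obtain ⟨b, -, rfl⟩ := hb
    simp

theorem mem_nodes_of_mem_nodeList {ψ : BoolFormula} {π : List Bool} (h : π ∈ ψ.nodeList) :
    π ∈ ψ.nodes := by
  induction ψ generalizing π with
  | leaf b =>
    simp only [nodeList, List.mem_singleton] at h
    simp [nodes, h, subAt]
  | gate o l r hl hr =>
    simp only [nodeList, List.mem_cons, List.mem_append, List.mem_map] at h
    rcases h with rfl | ⟨a, ha, rfl⟩ | ⟨a, ha, rfl⟩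
    · simp [nodes, subAt]
    · simpa [nodes, subAt] using hl ha
    · simpa [nodes, subAt] using hr ha

/-- The one use of the injectivity of the token assignment: rounds counted by the number of tokens
are enough for the number of nodes. -/
theorem size_le_of_injOn {N : ℕ} {ψ : BoolFormula} {tok : List Bool → Fin N}
    (h : Set.InjOn tok ψ.nodes) : ψ.size ≤ N := by
  have := Finset.card_le_card_of_injOn (s := ψ.nodeList.toFinset) (t := Finset.univ) tok
    (fun _ _ => Finset.mem_univ _)
    (fun a ha b hb => h (mem_nodes_of_mem_nodeList (by simpa using ha))
      (mem_nodes_of_mem_nodeList (by simpa using hb)))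
  rwa [List.toFinset_card_of_nodup ψ.nodup_nodeList, length_nodeList, Finset.card_univ,
    Fintype.card_fin] at this

/-- Whether the node `π` is a function node of type `o`. -/
def isGate (ψ : BoolFormula) (π : List Bool) (o : BoolOp) : Bool :=
  match ψ.subAt π with
  | some (gate o' _ _) => decide (o = o')
  | _ => false

/-- The arguments of a function node; a leaf is regarded as its own argument. -/
def child (ψ : BoolFormula) (π : List Bool) (d : Bool) : List Bool :=
  match ψ.subAt π with
  | some (gate _ _ _) => π ++ [d]
  | _ => π

/-! ### The rounds of the contraction and their soundness -/

/-- The state of the contraction: the nodes known to have value `b`, the active nodes, and for every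
node a descendant with the same value. -/
structure Contraction where
  known : List Bool → Bool → Bool
  active : List Bool → Bool
  ptr : List Bool → List Bool

/-- The connective whose value is `b` as soon as one argument is `b`. -/
def absorbed (b : Bool) : BoolOp := bif b then .or else .and

/-- Whether a node of type `gate` is found to have value `b`, where `via none` is what is known about
the node it points to, and `via (some d)` what is known about its arguments. -/
def learns (gate : BoolOp → Bool) (known : Bool → Bool) (via : Option Bool → Bool → Bool)
    (b : Bool) : Bool :=
  known b || via none b || (gate (absorbed b) && (via (some false) b || via (some true) b))

/-- Whether the argument `d` of a node of type `gate` is known to be neutral. -/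
def neutral (gate : BoolOp → Bool) (via : Option Bool → Bool → Bool) (d : Bool) : Bool :=
  (gate .and && via (some d) true) || (gate .or && via (some d) false)

/-- The argument to which a node starts to point. -/
def moves (gate : BoolOp → Bool) (active : Bool) (via : Option Bool → Bool → Bool) : Option Bool :=
  if active then none
  else if neutral gate via false then some true
  else if neutral gate via true then some false
  else none

namespace Contraction

def start (ψ : BoolFormula) : Contraction where
  known π b := match ψ.subAt π with
    | some (leaf c) => decide (b = c)
    | _ => false
  active _ := false
  ptr π := π

/-- What is known about the descendant and the arguments of a node. -/
def via (ψ : BoolFormula) (S : Contraction) (π : List Bool) : Option Bool → Bool → Bool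
  | none, b => S.known (S.ptr π) b
  | some d, b => S.known (ψ.child π d) b

/-- One round of the contraction. -/
def step (ψ : BoolFormula) (S : Contraction) : Contraction where
  known π b := learns (ψ.isGate π) (S.known π) (S.via ψ π) b
  active π := S.active π || neutral (ψ.isGate π) (S.via ψ π) false ||
    neutral (ψ.isGate π) (S.via ψ π) true
  ptr π := match moves (ψ.isGate π) (S.active π) (S.via ψ π) with
    | some d => ψ.child π d
    | none => S.ptr (S.ptr π)

/-- The value at a node. -/
def _root_.BoolFormula.evalAt (ψ : BoolFormula) (π : List Bool) : Option Bool :=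
  (ψ.subAt π).map eval

/-- `ptr_append` makes pointers only go down. Therefore a pointer that has moved never comes back,
and the flag `active` can record this once and for all. -/
structure Sound (ψ : BoolFormula) (S : Contraction) : Prop where
  known : ∀ π ∈ ψ.nodes, ∀ b, S.known π b = true → ψ.evalAt π = some b
  ptr_mem : ∀ π ∈ ψ.nodes, S.ptr π ∈ ψ.nodes
  ptr_eval : ∀ π ∈ ψ.nodes, ψ.evalAt (S.ptr π) = ψ.evalAt π
  ptr_append : ∀ π ∈ ψ.nodes, π <+: S.ptr π
  active : ∀ π ∈ ψ.nodes, S.active π = true ↔ S.ptr π ≠ π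
  leaf : ∀ π c, ψ.subAt π = some (.leaf c) → S.known π c = true

theorem sound_start (ψ : BoolFormula) : (start ψ).Sound ψ where
  known π hπ b h := by
    simp only [start] at h
    split at h
    · rename_i c hc
      simp at h
      simp [evalAt, hc, eval, h]
    · simp at h
  ptr_mem π hπ := hπ
  ptr_eval π hπ := rfl
  ptr_append π hπ := List.prefix_rfl
  active π hπ := by simp [start]
  leaf π c h := by simp [start, h]

theorem child_leaf {ψ : BoolFormula} {π : List Bool} {c : Bool} (h : ψ.subAt π = some (.leaf c))
    (d : Bool) : ψ.child π d = π := by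
  simp [child, h]

theorem child_gate {ψ : BoolFormula} {π : List Bool} {o : BoolOp} {l r : BoolFormula}
    (h : ψ.subAt π = some (.gate o l r)) (d : Bool) : ψ.child π d = π ++ [d] := by
  simp [child, h]

theorem child_mem {ψ : BoolFormula} {π : List Bool} (h : π ∈ ψ.nodes) (d : Bool) :
    ψ.child π d ∈ ψ.nodes := by
  obtain ⟨φ, hφ⟩ := Option.isSome_iff_exists.1 h
  cases φ with
  | leaf c => rwa [child_leaf hφ]
  | gate o l r =>
    rw [child_gate hφ]
    simp [nodes, subAt_child hφ]

theorem moves_leaf {ψ : BoolFormula} {π : List Bool} {c : Bool} (h : ψ.subAt π = some (.leaf c))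
    (a : Bool) (v : Option Bool → Bool → Bool) : moves (ψ.isGate π) a v = none := by
  simp [moves, neutral, isGate, h]

/-- The step either jumps, or starts to point at an argument. -/
theorem step_ptr {ψ : BoolFormula} {S : Contraction} (hS : S.Sound ψ) {π : List Bool}
    (hπ : π ∈ ψ.nodes) :
    (S.step ψ).ptr π = S.ptr (S.ptr π) ∨
      S.ptr π = π ∧ ∃ d o l r, ψ.subAt π = some (.gate o l r) ∧ (S.step ψ).ptr π = π ++ [d] ∧
        (S.known (π ++ [!d]) true = true ∧ o = .and ∨
          S.known (π ++ [!d]) false = true ∧ o = .or) := by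
  obtain ⟨φ, hφ⟩ := Option.isSome_iff_exists.1 hπ
  cases φ with
  | leaf c => left; simp [step, moves_leaf hφ]
  | gate o l r =>
    by_cases ha : S.active π = true
    · left; simp [step, moves, ha]
    have hp : S.ptr π = π := by
      by_contra hne
      exact ha ((hS.active π hπ).2 hne)
    by_cases h0 : neutral (ψ.isGate π) (S.via ψ π) false = true
    · right
      refine ⟨hp, true, o, l, r, hφ, by simp [step, moves, ha, h0, child_gate hφ], ?_⟩
      simp only [neutral, isGate, hφ, via, child_gate hφ] at h0
      cases o <;> simp_all
    by_cases h1 : neutral (ψ.isGate π) (S.via ψ π) true = true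
    · right
      refine ⟨hp, false, o, l, r, hφ, by simp [step, moves, ha, h0, h1, child_gate hφ], ?_⟩
      simp only [neutral, isGate, hφ, via, child_gate hφ] at h1
      cases o <;> simp_all
    left; simp [step, moves, ha, h0, h1]

theorem evalAt_gate {ψ : BoolFormula} {π : List Bool} {o : BoolOp} {l r : BoolFormula}
    (h : ψ.subAt π = some (.gate o l r)) :
    ψ.evalAt π = some (o.apply l.eval r.eval) ∧ ψ.evalAt (π ++ [false]) = some l.eval ∧
      ψ.evalAt (π ++ [true]) = some r.eval := by
  simp [evalAt, h, subAt_child h, eval]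

theorem Sound.step {ψ : BoolFormula} {S : Contraction} (hS : S.Sound ψ) : (S.step ψ).Sound ψ := by
  have mem_gate : ∀ {π o l r}, ψ.subAt π = some (.gate o l r) → ∀ d, π ++ [d] ∈ ψ.nodes := by
    intro π o l r h d
    simp [nodes, subAt_child h]
  refine ⟨?_, ?_, ?_, ?_, ?_, ?_⟩
  · intro π hπ b h
    simp only [Contraction.step, learns, Bool.or_eq_true, Bool.and_eq_true] at h
    rcases h with (h | h) | ⟨hg, h⟩
    · exact hS.known π hπ b h
    · rw [← hS.ptr_eval π hπ]
      exact hS.known _ (hS.ptr_mem π hπ) b h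
    · obtain ⟨φ, hφ⟩ := Option.isSome_iff_exists.1 hπ
      cases φ with
      | leaf c => simp [isGate, hφ] at hg
      | gate o l r =>
        simp only [via, child_gate hφ] at h
        have ho : absorbed b = o := by simpa [isGate, hφ] using hg
        obtain ⟨e, el, er⟩ := evalAt_gate hφ
        rw [e]
        rcases h with h | h
        · have := hS.known _ (mem_gate hφ _) b h
          rw [el, Option.some_inj] at this
          cases b <;> simp [← ho, absorbed, BoolOp.apply, this]
        · have := hS.known _ (mem_gate hφ _) b h
          rw [er, Option.some_inj] at this
          cases b <;> simp [← ho, absorbed, BoolOp.apply, this]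
  · intro π hπ
    rcases step_ptr hS hπ with h | ⟨-, d, o, l, r, hφ, h, -⟩
    · rw [h]; exact hS.ptr_mem _ (hS.ptr_mem _ hπ)
    · rw [h]; exact mem_gate hφ d
  · intro π hπ
    rcases step_ptr hS hπ with h | ⟨-, d, o, l, r, hφ, h, hk⟩
    · rw [h, hS.ptr_eval _ (hS.ptr_mem _ hπ), hS.ptr_eval _ hπ]
    · rw [h]
      obtain ⟨e, el, er⟩ := evalAt_gate hφ
      have hk' : ψ.evalAt (π ++ [!d]) = some true ∧ o = .and ∨
          ψ.evalAt (π ++ [!d]) = some false ∧ o = .or :=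
        hk.imp (fun h => ⟨hS.known _ (mem_gate hφ _) _ h.1, h.2⟩)
          (fun h => ⟨hS.known _ (mem_gate hφ _) _ h.1, h.2⟩)
      rw [e]
      cases d
      · rw [el]
        simp only [Bool.not_false, er, Option.some_inj] at hk'
        rcases hk' with ⟨h1, rfl⟩ | ⟨h1, rfl⟩ <;> simp [BoolOp.apply, h1]
      · rw [er]
        simp only [Bool.not_true, el, Option.some_inj] at hk'
        rcases hk' with ⟨h1, rfl⟩ | ⟨h1, rfl⟩ <;> simp [BoolOp.apply, h1]
  · intro π hπ
    rcases step_ptr hS hπ with h | ⟨-, d, o, l, r, hφ, h, -⟩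
    · rw [h]; exact (hS.ptr_append _ hπ).trans (hS.ptr_append _ (hS.ptr_mem _ hπ))
    · rw [h]; exact List.prefix_append _ _
  · intro π hπ
    by_cases ha : S.active π = true
    · have hm : (S.step ψ).ptr π = S.ptr (S.ptr π) := by simp [Contraction.step, moves, ha]
      rw [hm]
      -- If the jump ended at `π` again, the prefixes `π`, `S.ptr π`, `π` would force `S.ptr π = π`.
      have h1 := (hS.active π hπ).1 ha
      have h2 := hS.ptr_append _ hπ
      have h3 := hS.ptr_append _ (hS.ptr_mem _ hπ)
      simp only [Contraction.step, ha, Bool.true_or, true_iff]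
      intro h4
      rw [h4] at h3
      exact h1 (h3.eq_of_length (le_antisymm h3.length_le h2.length_le))
    · have hp : S.ptr π = π := by
        by_contra hne
        exact ha ((hS.active π hπ).2 hne)
      obtain ⟨φ, hφ⟩ := Option.isSome_iff_exists.1 hπ
      cases φ with
      | leaf c => simp [Contraction.step, ha, moves_leaf hφ, neutral, isGate, hφ, hp]
      | gate o l r =>
        by_cases h0 : neutral (ψ.isGate π) (S.via ψ π) false = true
        · simp [Contraction.step, moves, ha, h0, child_gate hφ]
        by_cases h1 : neutral (ψ.isGate π) (S.via ψ π) true = true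
        · simp [Contraction.step, moves, ha, h0, h1, child_gate hφ]
        simp [Contraction.step, moves, ha, h0, h1, hp]
  · intro π c h
    simp [Contraction.step, learns, hS.leaf π c h]

/-! ### Doubling of the evaluated size in a constant number of rounds -/

/-- The value of a node has been found. -/
def Done (S : Contraction) (π : List Bool) : Prop := ∃ b, S.known π b = true

theorem Done.step {S : Contraction} {π : List Bool} (ψ : BoolFormula) (h : S.Done π) :
    (S.step ψ).Done π := by
  obtain ⟨b, h⟩ := h
  exact ⟨b, by simp [Contraction.step, learns, h]⟩

theorem Done.step_of_ptr {S : Contraction} {π : List Bool} (ψ : BoolFormula)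
    (h : S.Done (S.ptr π)) : (S.step ψ).Done π := by
  obtain ⟨b, h⟩ := h
  exact ⟨b, by simp [Contraction.step, learns, via, h]⟩

/-- A known argument is either absorbing and settles the value, or neutral and lets the pointer
move, unless it has moved before. -/
theorem Sound.done_or_moved {ψ : BoolFormula} {S : Contraction} (hS : S.Sound ψ) {π : List Bool}
    (hπ : π ∈ ψ.nodes) {d : Bool} (h : S.Done (π ++ [d])) :
    (S.step ψ).Done π ∨ (S.step ψ).ptr π ≠ π := by
  obtain ⟨φ, hφ⟩ := Option.isSome_iff_exists.1 hπ
  cases φ with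
  | leaf c => exact .inl (Done.step ψ ⟨c, hS.leaf π c hφ⟩)
  | gate o l r =>
    obtain ⟨b, hb⟩ := h
    by_cases ho : absorbed b = o
    · left
      refine ⟨b, ?_⟩
      cases d <;> simp [Contraction.step, learns, via, child_gate hφ, isGate, hφ, ho, hb]
    · right
      rw [← hS.step.active π hπ]
      cases o <;> cases b <;> simp [absorbed] at ho <;> cases d <;>
        simp [Contraction.step, neutral, via, child_gate hφ, isGate, hφ, hb]

/-- From `π` to its descendant `ω` at least `m` nodes have been left behind, or both arguments of `ω`
have more than `m` nodes. -/
def Far (ψ : BoolFormula) (m : ℕ) (π ω : List Bool) : Prop :=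
  ψ.sizeAt ω + m ≤ ψ.sizeAt π ∨ ∀ d, m < ψ.sizeAt (ω ++ [d])

/-- A pointer that goes on from a node with two big arguments discards one of them entirely, more
than `m` nodes; the second alternative then turns into the first. -/
theorem Far.mono {ψ : BoolFormula} {m : ℕ} {π ω ω' : List Bool} (h : Far ψ m π ω)
    (hω : ω ∈ ψ.nodes) (hπ : π <+: ω) (h' : ω <+: ω') : Far ψ m π ω' := by
  obtain ⟨ρ, rfl⟩ := h'
  obtain ⟨σ, rfl⟩ := hπ
  rcases h with h | h
  · exact .inl (le_trans (by have := ψ.sizeAt_append_le (π ++ σ) ρ; omega) h)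
  · rcases ρ with _ | ⟨d, ρ⟩
    · exact .inr (by simpa using h)
    · left
      have h1 := sizeAt_append_cons hω d ρ
      have h2 := h (!d)
      have h3 := ψ.sizeAt_append_le π σ
      omega

theorem sizeAt_lt_of_child {ψ : BoolFormula} {m : ℕ} {π : List Bool} (hπ : π ∈ ψ.nodes)
    (h : ∀ d, m < ψ.sizeAt (π ++ [d])) : 2 * m < ψ.sizeAt π := by
  have h0 := h false
  have h1 := h true
  have := sizeAt_append_cons hπ false []
  simp only [Bool.not_false] at this
  omega

/-- Progress of the contraction. -/
structure Progress (ψ : BoolFormula) (m : ℕ) (S : Contraction) : Prop where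
  sound : S.Sound ψ
  done : ∀ π ∈ ψ.nodes, ψ.sizeAt π ≤ m → S.Done π
  far : ∀ π ∈ ψ.nodes, S.Done π ∨ Far ψ m π (S.ptr π)

theorem Sound.ptr_prefix_step {ψ : BoolFormula} {S : Contraction} (hS : S.Sound ψ)
    {π : List Bool} (hπ : π ∈ ψ.nodes) : S.ptr (S.ptr π) <+: (S.step ψ).ptr π := by
  rcases step_ptr hS hπ with h | ⟨h1, d, o, l, r, hφ, h, -⟩
  · rw [h]
  · rw [h, h1, h1]; exact List.prefix_append _ _

theorem Sound.ptr_prefix_step' {ψ : BoolFormula} {S : Contraction} (hS : S.Sound ψ)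
    {π : List Bool} (hπ : π ∈ ψ.nodes) : S.ptr π <+: (S.step ψ).ptr π :=
  (hS.ptr_append _ (hS.ptr_mem _ hπ)).trans (hS.ptr_prefix_step hπ)

theorem Progress.step {ψ : BoolFormula} {m : ℕ} {S : Contraction} (h : Progress ψ m S) :
    Progress ψ m (S.step ψ) where
  sound := h.sound.step
  done π hπ hs := (h.done π hπ hs).step ψ
  far π hπ := (h.far π hπ).imp (Done.step ψ) fun hf =>
    hf.mono (h.sound.ptr_mem π hπ) (h.sound.ptr_append π hπ) (h.sound.ptr_prefix_step' hπ)

/-- In the first alternative of `Far` the target has at most `m` nodes, so its value is known and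
gets copied. The second would give the target more than `2 * m` nodes. -/
theorem Progress.done_two_mul {ψ : BoolFormula} {m : ℕ} {S : Contraction} (h : Progress ψ m S)
    {π : List Bool} (hπ : π ∈ ψ.nodes) (hs : ψ.sizeAt π ≤ 2 * m) : (S.step ψ).Done π := by
  rcases h.far π hπ with hd | hf | hf
  · exact hd.step ψ
  · exact Done.step_of_ptr ψ (h.done _ (h.sound.ptr_mem π hπ) (by omega))
  · have h1 := sizeAt_lt_of_child (h.sound.ptr_mem π hπ) hf
    obtain ⟨ρ, hρ⟩ := h.sound.ptr_append π hπ
    have h2 := ψ.sizeAt_append_le π ρ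
    rw [hρ] at h2
    omega

/-- If a node is neither done nor contracted, then both arguments are big. -/
theorem Sound.done_or_moved_or_big {ψ : BoolFormula} {m : ℕ} {S : Contraction} (hS : S.Sound ψ)
    (hd : ∀ π ∈ ψ.nodes, ψ.sizeAt π ≤ m → S.Done π) {π : List Bool} (hπ : π ∈ ψ.nodes) :
    (S.step ψ).Done π ∨ (S.step ψ).ptr π ≠ π ∨ ∀ d, m < ψ.sizeAt (π ++ [d]) := by
  obtain ⟨φ, hφ⟩ := Option.isSome_iff_exists.1 hπ
  cases φ with
  | leaf c => exact .inl (Done.step ψ ⟨c, hS.leaf π c hφ⟩)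
  | gate o l r =>
    by_cases hb : ∀ d, m < ψ.sizeAt (π ++ [d])
    · exact .inr (.inr hb)
    · push Not at hb
      obtain ⟨d, hb⟩ := hb
      have := hS.done_or_moved hπ (hd _ (by simp [nodes, subAt_child hφ]) hb)
      tauto

/-- A node with a leaf as argument is decided or moves in the first round, and a pointer that has
moved has left at least its own node behind. This is why one round precedes the doublings. -/
theorem progress_one (ψ : BoolFormula) : Progress ψ 1 ((start ψ).step ψ) := by
  have hS := sound_start ψ
  have hd : ∀ π ∈ ψ.nodes, ψ.sizeAt π ≤ 1 → (start ψ).Done π := by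
    intro π hπ hs
    obtain ⟨φ, hφ⟩ := Option.isSome_iff_exists.1 hπ
    cases φ with
    | leaf c => exact ⟨c, hS.leaf π c hφ⟩
    | gate o l r =>
      have h0 := sizeAt_pos.2 (show π ++ [false] ∈ ψ.nodes by simp [nodes, subAt_child hφ])
      have := sizeAt_append_cons hπ false []
      omega
  refine ⟨hS.step, fun π hπ hs => (hd π hπ hs).step ψ, fun π hπ => ?_⟩
  rcases hS.done_or_moved_or_big hd hπ with h | h | h
  · exact .inl h
  · right; left
    obtain ⟨ρ, hρ⟩ := hS.step.ptr_append π hπ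
    rcases ρ with _ | ⟨d, ρ⟩
    · simp at hρ; exact absurd hρ.symm h
    · have := sizeAt_append_cons hπ d ρ
      rw [hρ] at this
      omega
  · right
    exact Far.mono (.inr h) hπ List.prefix_rfl (hS.step.ptr_append π hπ)

/-- When the target has itself moved on, following it always gains `m` nodes: either they were
already left behind, or a big argument is discarded now. -/
theorem far_of_moved {ψ : BoolFormula} {m : ℕ} {π ω ω' : List Bool} (h : Far ψ m π ω)
    (hω : ω ∈ ψ.nodes) (hπ : π <+: ω) (h' : ω <+: ω') (hne : ω' ≠ ω) :
    ψ.sizeAt ω' + m ≤ ψ.sizeAt π := by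
  obtain ⟨ρ, rfl⟩ := h'
  obtain ⟨σ, rfl⟩ := hπ
  have h3 := ψ.sizeAt_append_le π σ
  rcases h with h | h
  · have := ψ.sizeAt_append_le (π ++ σ) ρ; omega
  · rcases ρ with _ | ⟨d, ρ⟩
    · simp at hne
    · have h1 := sizeAt_append_cons hω d ρ
      have h2 := h (!d)
      omega

/-- The first round evaluates all nodes of size at most `2 * m`. In the second, every node with such
an argument is decided or has moved. The last two compose four pointers by jumping twice, and the
gain of `m` is collected twice, once per pair of hops. -/
theorem Progress.double {ψ : BoolFormula} {m : ℕ} {S : Contraction} (h : Progress ψ m S) :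
    Progress ψ (2 * m) ((Contraction.step ψ)^[4] S) := by
  have hd1 : ∀ π ∈ ψ.nodes, ψ.sizeAt π ≤ 2 * m → (S.step ψ).Done π := fun π hπ hs =>
    h.done_two_mul hπ hs
  set T := (S.step ψ).step ψ with hT
  have hP : Progress ψ m T := h.step.step
  have hA : ∀ π ∈ ψ.nodes, T.Done π ∨ T.ptr π ≠ π ∨ ∀ d, 2 * m < ψ.sizeAt (π ++ [d]) :=
    fun π hπ => h.sound.step.done_or_moved_or_big hd1 hπ
  have hTS := hP.sound
  have hTS1 := hTS.step
  have hTS2 := hTS1.step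
  change Progress ψ (2 * m) ((T.step ψ).step ψ)
  refine ⟨hTS2, fun π hπ hs => (((hd1 π hπ hs).step ψ).step ψ).step ψ, fun v hv => ?_⟩
  by_cases hdone : ((T.step ψ).step ψ).Done v
  · exact .inl hdone
  right
  have m1 := hTS.ptr_mem v hv
  have m2 := hTS.ptr_mem _ m1
  have m3 := hTS.ptr_mem _ m2
  have p1 := hTS.ptr_append v hv
  have p2 := hTS.ptr_append _ m1
  have p3 := hTS.ptr_append _ m2
  have p4 := hTS.ptr_append _ m3
  rcases step_ptr hTS hv with hgo | ⟨hstay, -⟩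
  · -- the pointer jumps in the first of the two remaining rounds
    have q4 : T.ptr (T.ptr (T.ptr (T.ptr v))) <+: ((T.step ψ).step ψ).ptr v := by
      have e1 := hTS1.ptr_prefix_step hv
      rw [hgo] at e1
      exact (hTS.ptr_prefix_step m2).trans e1
    have q3 := p4.trans q4
    have q2 := p3.trans q3
    have q1 := p2.trans q2
    -- A value known at one of the first four nodes of the chain would have reached `v` within the
    -- two rounds.
    have n0 : ¬ T.Done v := fun hh => hdone ((hh.step ψ).step ψ)
    have n1 : ¬ T.Done (T.ptr v) := fun hh => hdone ((hh.step_of_ptr ψ).step ψ)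
    have n2 : ¬ T.Done (T.ptr (T.ptr v)) := fun hh =>
      hdone (Done.step_of_ptr ψ (by rw [hgo]; exact hh.step ψ))
    have n3 : ¬ T.Done (T.ptr (T.ptr (T.ptr v))) := fun hh =>
      hdone (Done.step_of_ptr ψ (by rw [hgo]; exact hh.step_of_ptr ψ))
    -- A node of the chain that has not moved has two arguments of more than `2 * m` nodes, which is
    -- the second alternative of `Far` and carries over to the final target.
    rcases (hA v hv).resolve_left n0 with a0 | a0
    swap
    · exact Far.mono (.inr a0) hv List.prefix_rfl (hTS2.ptr_append v hv)
    rcases (hA _ m1).resolve_left n1 with a1 | a1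
    swap
    · exact Far.mono (.inr a1) m1 p1 q1
    rcases (hA _ m2).resolve_left n2 with a2 | a2
    swap
    · exact Far.mono (.inr a2) m2 (p1.trans p2) q2
    rcases (hA _ m3).resolve_left n3 with a3 | a3
    swap
    · exact Far.mono (.inr a3) m3 ((p1.trans p2).trans p3) q3
    -- All four nodes have moved: two hops from `v` gain `m`, and two more gain `m` again.
    have f1 := far_of_moved ((hP.far v hv).resolve_left n0) m1 p1 p2 a1
    have f2 := far_of_moved ((hP.far _ m2).resolve_left n2) m3 p3 p4 a3
    left
    obtain ⟨ρ, hρ⟩ := q4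
    have := ψ.sizeAt_append_le (T.ptr (T.ptr (T.ptr (T.ptr v)))) ρ
    rw [hρ] at this
    omega
  · rcases hA v hv with a0 | a0 | a0
    · exact absurd ((a0.step ψ).step ψ) hdone
    · exact absurd hstay a0
    · exact Far.mono (.inr a0) hv List.prefix_rfl (hTS2.ptr_append v hv)

/-- The state of the contraction after `t` rounds. -/
def iter (ψ : BoolFormula) (t : ℕ) : Contraction := (step ψ)^[t] (start ψ)

theorem iter_succ (ψ : BoolFormula) (t : ℕ) : iter ψ (t + 1) = (iter ψ t).step ψ := by
  simp [iter, Function.iterate_succ_apply']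

theorem sound_iter (ψ : BoolFormula) (t : ℕ) : (iter ψ t).Sound ψ := by
  induction t with
  | zero => exact sound_start ψ
  | succ t ih => rw [iter_succ]; exact ih.step

theorem progress_pow (ψ : BoolFormula) (j : ℕ) : Progress ψ (2 ^ j) (iter ψ (4 * j + 1)) := by
  induction j with
  | zero => exact progress_one ψ
  | succ j ih =>
    have : iter ψ (4 * (j + 1) + 1) = (step ψ)^[4] (iter ψ (4 * j + 1)) := by
      rw [iter, iter, ← Function.iterate_add_apply, show 4 * (j + 1) + 1 = 4 + (4 * j + 1) by ring]
    rw [this, pow_succ']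
    exact ih.double

/-- After logarithmically many rounds all values are known. -/
theorem known_iff {ψ : BoolFormula} {j : ℕ} (hj : ψ.size ≤ 2 ^ j) {π : List Bool}
    {φ : BoolFormula} (h : ψ.subAt π = some φ) (b : Bool) :
    (iter ψ (4 * j + 1)).known π b = decide (φ.eval = b) := by
  have hP := progress_pow ψ j
  have hπ : π ∈ ψ.nodes := by simp [nodes, h]
  obtain ⟨c, hc⟩ := hP.done π hπ ((ψ.size_subAt_le π).trans hj)
  have key : ∀ b, (iter ψ (4 * j + 1)).known π b = true → φ.eval = b := fun b hb => by
    simpa [evalAt, h] using hP.sound.known π hπ b hb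
  have ec := key c hc
  by_cases hb : φ.eval = b
  · rw [← hb, ec, hc]; simp
  · rw [decide_eq_false hb]
    by_contra hne
    exact hb (key b (by simpa using hne))

end Contraction

end BoolFormula

/-! ## Exact computations in limited precision -/

namespace AHAT

/-- The multiples of `2 ^ (-p)`. -/
def Grid (p : ℕ) (x : ℝ) : Prop := ∃ n : ℤ, x = n / 2 ^ p

theorem grid_int (p : ℕ) (n : ℤ) : Grid p n :=
  ⟨n * 2 ^ p, by push_cast; field_simp⟩

theorem Grid.add {p : ℕ} {x y : ℝ} (hx : Grid p x) (hy : Grid p y) : Grid p (x + y) := by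
  obtain ⟨a, rfl⟩ := hx
  obtain ⟨b, rfl⟩ := hy
  exact ⟨a + b, by push_cast; ring⟩

theorem Grid.intMul {p : ℕ} {x : ℝ} (n : ℤ) (hx : Grid p x) : Grid p (n * x) := by
  obtain ⟨a, rfl⟩ := hx
  exact ⟨n * a, by push_cast; ring⟩

theorem Grid.mono {p q : ℕ} {x : ℝ} (h : p ≤ q) (hx : Grid p x) : Grid q x := by
  obtain ⟨a, rfl⟩ := hx
  obtain ⟨d, rfl⟩ := Nat.exists_eq_add_of_le h
  exact ⟨a * 2 ^ d, by push_cast; rw [pow_add]; field_simp⟩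

theorem grid_half {p : ℕ} (hp : 1 ≤ p) : Grid p (1 / 2) :=
  Grid.mono hp ⟨1, by norm_num⟩

theorem abs_rnd_le (p : ℕ) (x : ℝ) : |rnd p x| ≤ 2 ^ p := by
  have h : (0 : ℝ) < 2 ^ p := by positivity
  rw [abs_le, rnd]
  exact ⟨le_max_left _ _, max_le (by linarith) (min_le_left _ _)⟩

theorem grid_rnd (p : ℕ) (x : ℝ) : Grid p (rnd p x) := by
  have h : Grid p ((2 : ℝ) ^ p) := by simpa using grid_int p (2 ^ p)
  have h' : Grid p (-(2 : ℝ) ^ p) := by simpa using grid_int p (-2 ^ p)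
  unfold rnd
  rcases max_choice (-(2 : ℝ) ^ p) (min (2 ^ p) ((round (x * 2 ^ p) : ℝ) / 2 ^ p)) with e | e <;>
    rw [e]
  · exact h'
  · rcases min_choice ((2 : ℝ) ^ p) ((round (x * 2 ^ p) : ℝ) / 2 ^ p) with e | e <;> rw [e]
    · exact h
    · exact ⟨_, rfl⟩

theorem rnd_eq_self {p : ℕ} {x : ℝ} (hx : Grid p x) (h : |x| ≤ 2 ^ p) : rnd p x = x := by
  obtain ⟨n, rfl⟩ := hx
  rw [abs_le] at h
  have e : (n : ℝ) / 2 ^ p * 2 ^ p = n := by field_simp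
  rw [rnd, e, round_intCast, min_eq_right h.2, max_eq_right h.1]

theorem representable_iff {p : ℕ} {x : ℝ} : Representable p x ↔ Grid p x ∧ |x| ≤ 2 ^ p :=
  ⟨fun h => by rw [← (h : rnd p x = x)]; exact ⟨grid_rnd p x, abs_rnd_le p x⟩,
    fun h => rnd_eq_self h.1 h.2⟩

theorem rnd_rnd (p : ℕ) (x : ℝ) : rnd p (rnd p x) = rnd p x :=
  rnd_eq_self (grid_rnd p x) (abs_rnd_le p x)

theorem Representable.mono {p q : ℕ} {x : ℝ} (h : p ≤ q) (hx : Representable p x) :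
    Representable q x := by
  rw [representable_iff] at *
  exact ⟨hx.1.mono h, hx.2.trans (pow_le_pow_right₀ (by norm_num) h)⟩

theorem representable_of_small {p : ℕ} {n : ℤ} (h : |n| ≤ 1) : Representable p (n : ℝ) := by
  rw [representable_iff]
  refine ⟨grid_int p n, ?_⟩
  have : |(n : ℝ)| ≤ 1 := by exact_mod_cast h
  exact this.trans (one_le_pow₀ (by norm_num))

theorem rnd_zero (p : ℕ) : rnd p 0 = 0 := by
  simpa [Representable] using representable_of_small (p := p) (n := 0) (by simp)

theorem rnd_one (p : ℕ) : rnd p 1 = 1 := by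
  simpa [Representable] using representable_of_small (p := p) (n := 1) (by simp)

theorem rnd_neg_one (p : ℕ) : rnd p (-1) = -1 := by
  simpa [Representable] using representable_of_small (p := p) (n := -1) (by simp)

theorem rnd_half {p : ℕ} (hp : 1 ≤ p) : rnd p (1 / 2) = 1 / 2 :=
  rnd_eq_self (grid_half hp) (by
    rw [abs_of_pos (by norm_num)]
    have : (1 : ℝ) ≤ 2 ^ p := one_le_pow₀ (by norm_num)
    linarith)

theorem rnd_neg_half {p : ℕ} (hp : 1 ≤ p) : rnd p (-(1 / 2)) = -(1 / 2) :=
  rnd_eq_self (by simpa using (grid_half hp).intMul (-1)) (by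
    rw [abs_neg, abs_of_pos (by norm_num)]
    have : (1 : ℝ) ≤ 2 ^ p := one_le_pow₀ (by norm_num)
    linarith)

theorem rnd_mono (p : ℕ) : Monotone (rnd p) := by
  intro x y h
  have h2 : (0 : ℝ) < 2 ^ p := by positivity
  have : round (x * 2 ^ p) ≤ round (y * 2 ^ p) := by
    rw [round_eq, round_eq]
    exact Int.floor_le_floor (by nlinarith)
  unfold rnd
  have h3 : (round (x * 2 ^ p) : ℝ) ≤ round (y * 2 ^ p) := by exact_mod_cast this
  gcongr

theorem abs_rnd_le_one {p : ℕ} {x : ℝ} (h : |x| ≤ 1) : |rnd p x| ≤ 1 := by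
  rw [abs_le] at *
  have h1 := rnd_mono p h.1
  have h2 := rnd_mono p h.2
  rw [rnd_neg_one] at h1
  rw [rnd_one] at h2
  exact ⟨h1, h2⟩

theorem rnd_nonneg {p : ℕ} {x : ℝ} (h : 0 ≤ x) : 0 ≤ rnd p x := by
  simpa [rnd_zero] using rnd_mono p h

theorem abs_rnd_sub_le {p : ℕ} {x : ℝ} (h : |x| ≤ 2 ^ p) : |rnd p x - x| ≤ 1 / 2 ^ p := by
  have h2 : (0 : ℝ) < 2 ^ p := by positivity
  rw [abs_le] at h
  have h3 := abs_sub_round (x * 2 ^ p)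
  set y := (round (x * 2 ^ p) : ℝ) / 2 ^ p with hy
  have h4 : |y - x| ≤ 1 / 2 ^ p := by
    have e : y - x = -((x * 2 ^ p - round (x * 2 ^ p)) / 2 ^ p) := by rw [hy]; field_simp; ring
    rw [e, abs_neg, abs_div, abs_of_pos h2]
    gcongr
    linarith
  rw [abs_le] at *
  unfold rnd
  constructor
  · rw [← hy]
    have : x - 1 / 2 ^ p ≤ min (2 ^ p) y := le_min (by have := one_div_pos.2 h2; linarith) (by linarith)
    linarith [le_max_right (-(2 : ℝ) ^ p) (min (2 ^ p) y)]
  · rw [← hy]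
    have : max (-(2 : ℝ) ^ p) (min (2 ^ p) y) ≤ x + 1 / 2 ^ p :=
      max_le (by have := one_div_pos.2 h2; linarith) ((min_le_right _ _).trans (by linarith))
    linarith

/-! ### Sparse integer matrices -/

section Sparse

set_option linter.unusedSectionVars false

variable {F G : Type} [DecidableEq F] [DecidableEq G]

/-- The row vector with the listed coefficients. -/
def row (l : List (ℤ × F)) (f : F) : ℤ := (l.map fun a => if a.2 = f then a.1 else 0).sum

/-- The sum of the absolute values of the coefficients. -/
def weight (l : List (ℤ × F)) : ℕ := (l.map fun a => a.1.natAbs).sum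

/-- The value of the linear form with the listed coefficients. -/
def combo (l : List (ℤ × F)) (z : F → ℝ) : ℝ := (l.map fun a => (a.1 : ℝ) * z a.2).sum

theorem sum_row [Fintype F] (l : List (ℤ × F)) (z : F → ℝ) :
    ∑ f, (row l f : ℝ) * z f = combo l z := by
  induction l with
  | nil => simp [row, combo]
  | cons a l ih =>
    simp only [row, combo, List.map_cons, List.sum_cons, Int.cast_add, add_mul,
      Finset.sum_add_distrib] at *
    rw [ih]
    simp

theorem abs_row_le (l : List (ℤ × F)) (f : F) : |row l f| ≤ weight l := by
  induction l with
  | nil => simp [row, weight]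
  | cons a l ih =>
    simp only [row, weight, List.map_cons, List.sum_cons, Nat.cast_add] at *
    refine (abs_add_le _ _).trans (add_le_add ?_ ih)
    split <;> simp

theorem grid_combo {p : ℕ} {l : List (ℤ × F)} {z : F → ℝ} (h : ∀ a ∈ l, Grid p (z a.2)) :
    Grid p (combo l z) := by
  induction l with
  | nil => simpa [combo] using grid_int p 0
  | cons a l ih =>
    simp only [combo, List.map_cons, List.sum_cons]
    exact ((h a (by simp)).intMul _).add (ih fun b hb => h b (by simp [hb]))

theorem abs_combo_le {l : List (ℤ × F)} {z : F → ℝ} (h : ∀ f, |z f| ≤ 1) :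
    |combo l z| ≤ weight l := by
  induction l with
  | nil => simp [combo, weight]
  | cons a l ih =>
    simp only [combo, weight, List.map_cons, List.sum_cons, Nat.cast_add] at *
    refine (abs_add_le _ _).trans (add_le_add ?_ ih)
    rw [abs_mul, Nat.cast_natAbs, Int.cast_abs]
    exact mul_le_of_le_one_right (abs_nonneg _) (h _)

theorem rnd_int_of_le {p : ℕ} {n : ℤ} (h : |n| ≤ 2 ^ p) : rnd p n = n :=
  rnd_eq_self (grid_int p n) (by exact_mod_cast h)

theorem rnd_row {p : ℕ} {l : List (ℤ × F)} (hl : weight l ≤ 2 ^ p) (f : F) :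
    rnd p (row l f) = row l f :=
  rnd_int_of_le ((abs_row_le l f).trans (by exact_mod_cast hl))

/-- Integer coefficients of total weight at most `2 ^ p` are fixed by rounding, so only the rounding
of the result remains. -/
theorem linMap_row {p : ℕ} {κ : Type} [Fintype F] {W : Matrix κ F ℝ} {l : List (ℤ × F)} {i : κ}
    (hW : ∀ f, W i f = row l f) (hl : weight l ≤ 2 ^ p) (x : F → ℝ) :
    linMap p W x i = rnd p (combo l x) := by
  unfold linMap
  congr 1
  rw [← sum_row]
  exact Finset.sum_congr rfl fun f _ => by rw [hW, rnd_row hl]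

theorem combo_neg (l : List (ℤ × F)) (x : F → ℝ) :
    combo (l.map fun a => (-a.1, a.2)) x = -combo l x := by
  induction l with
  | nil => simp [combo]
  | cons a l ih =>
    simp only [combo, List.map_cons, List.sum_cons] at *
    rw [ih]; push_cast; ring

/-- Rename the coordinates of a linear form. -/
def relabel (e : F → G) (l : List (ℤ × F)) : List (ℤ × G) := l.map fun a => (a.1, e a.2)

theorem weight_relabel (e : F → G) (l : List (ℤ × F)) : weight (relabel e l) = weight l := by
  simp [weight, relabel, Function.comp_def]

theorem combo_relabel (e : F → G) (l : List (ℤ × F)) (z : G → ℝ) :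
    combo (relabel e l) z = combo l (z ∘ e) := by
  simp [combo, relabel, Function.comp_def]

end Sparse

/-! ### Normalization of pairs -/

/-- The vector `(v, -v)` scaled to norm one, up to sign. -/
def unit (v : Bool → ℝ) (s : Bool) : ℝ := v s / √(2 * (v false ^ 2 + v true ^ 2))

def hat (p : ℕ) (v : Bool → ℝ) (s : Bool) : ℝ := rnd p (unit v s)

theorem abs_layerNorm_le {κ : Type} {S : Finset κ} (y : κ → ℝ) {j : κ} (hj : j ∈ S) :
    |layerNorm S y j| ≤ 1 := by
  unfold layerNorm
  rw [abs_div, abs_of_nonneg (Real.sqrt_nonneg _)]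
  refine div_le_one_of_le₀ ?_ (Real.sqrt_nonneg _)
  refine Real.abs_le_sqrt ?_
  exact Finset.single_le_sum (f := fun l => (y l - (∑ l' ∈ S, y l') / S.card) ^ 2)
    (fun _ _ => sq_nonneg _) hj

section PairNorm

variable {ι B : Type} [DecidableEq ι] [Fintype B] [DecidableEq B]

/-- The position of a row of a block of two linear forms and their negatives. -/
def rowIdx (B : Type) [Fintype B] [DecidableEq B] :
    B × Bool × Bool ≃ Fin (Fintype.card (B × Bool × Bool)) :=
  Fintype.equivFin _

/-- The rows of blocks of two linear forms and their negatives. -/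
def pairProj (w : B → Bool → List (ℤ × ι)) : Matrix (Fin (Fintype.card (B × Bool × Bool))) ι ℝ :=
  fun j c => row ((w ((rowIdx B).symm j).1 ((rowIdx B).symm j).2.2).map
    fun a => (bif ((rowIdx B).symm j).2.1 then -a.1 else a.1, a.2)) c

def pairBlock (B : Type) [Fintype B] [DecidableEq B] (j : Fin (Fintype.card (B × Bool × Bool))) :
    ℕ :=
  Fintype.equivFin B ((rowIdx B).symm j).1

/-- The multi-pre-norm whose blocks consist of two linear forms and their negatives. -/
abbrev pairNorm (w : B → Bool → List (ℤ × ι)) : PreNorm ι where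
  dim := Fintype.card (B × Bool × Bool)
  proj := pairProj w
  block := pairBlock B

/-- The position of the normalized linear form `f.2` of block `f.1`. -/
def featIdx (f : B × Bool) : Fin (Fintype.card (B × Bool × Bool)) :=
  rowIdx B (f.1, false, f.2)

variable [Fintype ι]

/-- The normalized linear forms. -/
def feat (w : B → Bool → List (ℤ × ι)) (p : ℕ) (x : ι → ℝ) (f : B × Bool) : ℝ :=
  (pairNorm w).eval p x (featIdx f)

theorem abs_feat_le (w : B → Bool → List (ℤ × ι)) (p : ℕ) (x : ι → ℝ) (f : B × Bool) :
    |feat w p x f| ≤ 1 :=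
  abs_rnd_le_one (abs_layerNorm_le _ (Finset.mem_filter.2 ⟨Finset.mem_univ _, rfl⟩))

theorem grid_feat (w : B → Bool → List (ℤ × ι)) (p : ℕ) (x : ι → ℝ) (f : B × Bool) :
    Grid p (feat w p x f) :=
  grid_rnd _ _

theorem sum_block (b : B) (y : Fin (Fintype.card (B × Bool × Bool)) → ℝ) :
    ∑ l ∈ Finset.univ.filter fun l => pairBlock B l = (Fintype.equivFin B b : Fin _), y l =
      y (rowIdx B (b, false, false)) + y (rowIdx B (b, false, true)) +
        (y (rowIdx B (b, true, false)) + y (rowIdx B (b, true, true))) := by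
  rw [Finset.sum_filter, ← (rowIdx B).sum_comp, Fintype.sum_prod_type]
  simp [pairBlock, Fin.val_inj, Fintype.sum_prod_type]
  ring

/-- A block contains each form and its negative, so its mean vanishes and layer-norm is plain
scaling. The factor 2 in `unit` counts the negatives. -/
theorem feat_eq {w : B → Bool → List (ℤ × ι)} {p : ℕ} {x : ι → ℝ} {b : B} {v : Bool → ℝ}
    (hw : ∀ s, weight (w b s) ≤ 2 ^ p) (hv : ∀ s, combo (w b s) x = v s)
    (hr : ∀ s, Representable p (v s)) (s : Bool) : feat w p x (b, s) = hat p v s := by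
  have hp : ∀ s, linMap p (pairProj w) x (rowIdx B (b, false, s)) = v s := by
    intro s
    rw [linMap_row (l := w b s) _ (hw s), hv, hr]
    intro c
    simp [pairProj]
  have hn : ∀ s, linMap p (pairProj w) x (rowIdx B (b, true, s)) = -v s := by
    intro s
    rw [linMap_row (l := (w b s).map fun a => (-a.1, a.2)) _ _, combo_neg, hv]
    · have := hr s
      rw [representable_iff] at this
      exact rnd_eq_self (by simpa using this.1.intMul (-1)) (by rw [abs_neg]; exact this.2)
    · intro c
      simp [pairProj]
    · refine le_trans (le_of_eq ?_) (hw s)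
      simp [weight, Function.comp_def]
  unfold feat hat PreNorm.eval featIdx
  congr 1
  have key : ∀ y : Fin (Fintype.card (B × Bool × Bool)) → ℝ,
      y (rowIdx B (b, false, false)) = v false → y (rowIdx B (b, false, true)) = v true →
      y (rowIdx B (b, true, false)) = -v false → y (rowIdx B (b, true, true)) = -v true →
      layerNorm (Finset.univ.filter fun l =>
        pairBlock B l = (Fintype.equivFin B b : Fin _)) y
          (rowIdx B (b, false, s)) = unit v s := by
    intro y h1 h2 h3 h4
    have hs : y (rowIdx B (b, false, s)) = v s := by cases s <;> assumption
    unfold layerNorm unit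
    rw [sum_block, sum_block, h1, h2, h3, h4, hs]
    have : v false + v true + (-v false + -v true) = 0 := by ring
    rw [this]
    congr 1
    · simp
    · congr 1; ring
  have := key (linMap p (pairProj w) x) (hp _) (hp _) (hn _) (hn _)
  rw [← this]
  congr 2
  simp [pairBlock]

end PairNorm

/-- Two equal numbers are normalized exactly. -/
theorem hat_const {p : ℕ} (hp : 1 ≤ p) {v : Bool → ℝ} (h0 : v false = 1) (h1 : v true = 1)
    (s : Bool) : hat p v s = 1 / 2 := by
  have e : √(2 * ((1 : ℝ) ^ 2 + 1 ^ 2)) = 2 := by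
    rw [show (2 * ((1 : ℝ) ^ 2 + 1 ^ 2)) = 2 ^ 2 by norm_num]
    exact Real.sqrt_sq (by norm_num)
  unfold hat unit
  rw [h0, h1, e]
  cases s <;> simp only [h0, h1] <;> exact rnd_half hp

/-- The number that represents a truth value. -/
def bit (b : Bool) : ℝ := bif b then 1 else 0

theorem bit_true : bit true = 1 := rfl

theorem bit_false : bit false = 0 := rfl

theorem representable_bit (p : ℕ) (b : Bool) : Representable p (bit b) := by
  cases b
  · exact rnd_zero p
  · exact rnd_one p

/-- A sign is normalized exactly. -/
theorem hat_bit {p : ℕ} (hp : 1 ≤ p) {v : Bool → ℝ} {b : Bool}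
    (h0 : v false = 2 * bit b - 1) (h1 : v true = 1) : hat p v false = bit b - 1 / 2 := by
  have e : ∀ y : ℝ, y ^ 2 = 1 → √(2 * (y ^ 2 + 1 ^ 2)) = 2 := by
    intro y hy
    rw [hy, show (2 * ((1 : ℝ) + 1 ^ 2)) = 2 ^ 2 by norm_num]
    exact Real.sqrt_sq (by norm_num)
  unfold hat unit
  rw [h0, h1, e _ (by cases b <;> norm_num [bit])]
  cases b
  · rw [bit_false, show (2 * (0 : ℝ) - 1) / 2 = -(1 / 2) by norm_num, rnd_neg_half hp]
    norm_num
  · rw [bit_true, show (2 * (1 : ℝ) - 1) / 2 = 1 / 2 by norm_num, rnd_half hp]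
    norm_num

end AHAT

/-! ## Pointers as directions -/

namespace AHAT

/-- The direction that points to position `m`. -/
def dir (m : ℕ) (s : Bool) : ℝ := bif s then 1 else m

/-- `v` is the normalized direction of `m`, up to an error of `ε`. -/
def Near (ε : ℝ) (m : ℕ) (v : Bool → ℝ) : Prop := ∀ s, |v s - unit (dir m) s| ≤ ε

theorem Near.mono {ε δ : ℝ} {m : ℕ} {v : Bool → ℝ} (h : Near ε m v) (hε : ε ≤ δ) : Near δ m v :=
  fun s => (h s).trans hε

theorem unit_smul {c : ℝ} (hc : 0 < c) (v : Bool → ℝ) (s : Bool) :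
    unit (fun s => c * v s) s = unit v s := by
  unfold unit
  rw [show 2 * ((c * v false) ^ 2 + (c * v true) ^ 2) = c ^ 2 * (2 * (v false ^ 2 + v true ^ 2)) by
    ring, Real.sqrt_mul (by positivity), Real.sqrt_sq hc.le, mul_div_mul_left _ _ hc.ne']

theorem abs_unit_le (v : Bool → ℝ) (s : Bool) : |unit v s| ≤ 1 := by
  unfold unit
  rw [abs_div, abs_of_nonneg (Real.sqrt_nonneg _)]
  refine div_le_one_of_le₀ (Real.abs_le_sqrt ?_) (Real.sqrt_nonneg _)
  cases s <;> nlinarith [sq_nonneg (v false), sq_nonneg (v true)]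

theorem hat_nonneg (p : ℕ) {v : Bool → ℝ} {s : Bool} (h : 0 ≤ v s) : 0 ≤ hat p v s :=
  rnd_nonneg (div_nonneg h (Real.sqrt_nonneg _))

theorem representable_hat (p : ℕ) (v : Bool → ℝ) (s : Bool) : Representable p (hat p v s) :=
  rnd_rnd _ _

theorem sq_unit_dir (m : ℕ) : 2 * (unit (dir m) false ^ 2 + unit (dir m) true ^ 2) = 1 := by
  have h : (0 : ℝ) < 2 * ((m : ℝ) ^ 2 + 1) := by positivity
  simp only [unit, dir, cond_false, cond_true, one_pow]
  rw [div_pow, div_pow, Real.sq_sqrt h.le]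
  field_simp

theorem unit_dir_nonneg (m : ℕ) (s : Bool) : 0 ≤ unit (dir m) s :=
  div_nonneg (by cases s <;> simp [dir]) (Real.sqrt_nonneg _)

/-- A vector within `ε` of the normalized direction has (doubled) norm within `5 * ε` of 1;
rescaling it therefore adds at most `5 * ε` to the error. -/
theorem Near.unit {ε : ℝ} {m : ℕ} {v : Bool → ℝ} (h : Near ε m v) (hε : ε ≤ 1 / 16) :
    Near (6 * ε) m (unit v) := by
  have h0 := h false
  have h1 := h true
  have e0 : 0 ≤ ε := (abs_nonneg _).trans h0
  have hw := sq_unit_dir m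
  have w0 := unit_dir_nonneg m false
  have w1 := unit_dir_nonneg m true
  set a := AHAT.unit (dir m) false with ha
  set b := AHAT.unit (dir m) true with hb
  have hab : a + b ≤ 1 := by nlinarith [sq_nonneg (a - b), sq_nonneg (a + b - 1)]
  set n := √(2 * (v false ^ 2 + v true ^ 2)) with hn
  have hn0 : 0 ≤ n := Real.sqrt_nonneg _
  have hn2 : n ^ 2 = 2 * (v false ^ 2 + v true ^ 2) := Real.sq_sqrt (by positivity)
  rw [abs_le] at h0 h1
  have hsq : |n ^ 2 - 1| ≤ 5 * ε := by
    obtain ⟨x, hx⟩ : ∃ x, x = v false - a := ⟨_, rfl⟩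
    obtain ⟨y, hy⟩ : ∃ y, y = v true - b := ⟨_, rfl⟩
    have ex : v false = a + x := by rw [hx]; ring
    have ey : v true = b + y := by rw [hy]; ring
    rw [← hx] at h0
    rw [← hy] at h1
    rw [hn2, ex, ey, ← hw]
    have e : 2 * ((a + x) ^ 2 + (b + y) ^ 2) - 2 * (a ^ 2 + b ^ 2) =
        4 * (a * x + b * y) + 2 * (x ^ 2 + y ^ 2) := by ring
    rw [e]
    have q1 : x ^ 2 ≤ ε ^ 2 := sq_le_sq' h0.1 h0.2
    have q2 : y ^ 2 ≤ ε ^ 2 := sq_le_sq' h1.1 h1.2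
    have q3 : a * x ≤ a * ε := mul_le_mul_of_nonneg_left h0.2 w0
    have q4 : b * y ≤ b * ε := mul_le_mul_of_nonneg_left h1.2 w1
    have q5 : a * (-ε) ≤ a * x := mul_le_mul_of_nonneg_left h0.1 w0
    have q6 : b * (-ε) ≤ b * y := mul_le_mul_of_nonneg_left h1.1 w1
    have q7 : (a + b) * ε ≤ 1 * ε := mul_le_mul_of_nonneg_right hab e0
    have q8 : ε ^ 2 ≤ ε * (1 / 16) := by nlinarith
    rw [abs_le]
    constructor <;> nlinarith [sq_nonneg x, sq_nonneg y]
  have hn1 : |n - 1| ≤ 5 * ε := by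
    have e : n ^ 2 - 1 = (n - 1) * (n + 1) := by ring
    rw [e, abs_mul, abs_of_nonneg (by linarith : 0 ≤ n + 1)] at hsq
    nlinarith [abs_nonneg (n - 1)]
  have hnpos : 0 < n := by
    rw [abs_le] at hn1
    linarith
  intro s
  have hs := h s
  have hu := abs_unit_le v s
  have e : AHAT.unit v s - AHAT.unit (dir m) s =
      AHAT.unit v s * (1 - n) + (v s - AHAT.unit (dir m) s) := by
    have : AHAT.unit v s * n = v s := by
      simp only [AHAT.unit, ← hn]; field_simp
    rw [mul_sub, this]; ring
  rw [e]
  refine (abs_add_le _ _).trans ?_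
  rw [abs_mul, abs_sub_comm 1 n]
  nlinarith [abs_nonneg (n - 1)]

theorem abs_hat_sub_le (p : ℕ) (v : Bool → ℝ) (s : Bool) : |hat p v s - unit v s| ≤ 1 / 2 ^ p :=
  abs_rnd_sub_le ((abs_unit_le v s).trans (one_le_pow₀ (by norm_num)))

/-- In units of `2 ^ (-p)`, a rounded normalization changes the error by `c ↦ 6 * c + 1`. -/
theorem Near.hat {c : ℝ} {p m : ℕ} {v : Bool → ℝ} (h : Near (c / 2 ^ p) m v)
    (hc : 16 * c ≤ 2 ^ p) : Near ((6 * c + 1) / 2 ^ p) m (hat p v) := by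
  have h2 : (0 : ℝ) < 2 ^ p := by positivity
  have h1 := h.unit (by rw [div_le_iff₀ h2]; linarith)
  intro s
  have e : AHAT.hat p v s - AHAT.unit (dir m) s =
      (AHAT.hat p v s - AHAT.unit v s) + (AHAT.unit v s - AHAT.unit (dir m) s) := by ring
  rw [e]
  refine (abs_add_le _ _).trans ((add_le_add (abs_hat_sub_le p v s) (h1 s)).trans (le_of_eq ?_))
  ring

theorem near_hat_dir (p m : ℕ) : Near (1 / 2 ^ p) m (hat p (dir m)) := abs_hat_sub_le p _

/-- The directions of different positions can be told apart. -/
theorem dot_dir_le {N m j : ℕ} (hm : m < N) (hj : j < N) (hne : m ≠ j) :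
    unit (dir m) false * unit (dir j) false + unit (dir m) true * unit (dir j) true +
      1 / (4 * N ^ 4) ≤ 1 / 2 := by
  have hA : (0 : ℝ) < (m : ℝ) ^ 2 + 1 := by positivity
  have hB : (0 : ℝ) < (j : ℝ) ^ 2 + 1 := by positivity
  set X := √(((m : ℝ) ^ 2 + 1) * ((j : ℝ) ^ 2 + 1)) with hX
  have hXpos : 0 < X := Real.sqrt_pos.2 (by positivity)
  have hX2 : X ^ 2 = ((m : ℝ) ^ 2 + 1) * ((j : ℝ) ^ 2 + 1) := Real.sq_sqrt (by positivity)
  have e2 : √(2 * ((m : ℝ) ^ 2 + 1)) * √(2 * ((j : ℝ) ^ 2 + 1)) = 2 * X := by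
    rw [← Real.sqrt_mul (by positivity), hX, show 2 * ((m : ℝ) ^ 2 + 1) * (2 * ((j : ℝ) ^ 2 + 1)) =
      2 ^ 2 * (((m : ℝ) ^ 2 + 1) * ((j : ℝ) ^ 2 + 1)) by ring, Real.sqrt_mul (by positivity),
      Real.sqrt_sq (by norm_num)]
  have e : unit (dir m) false * unit (dir j) false + unit (dir m) true * unit (dir j) true =
      ((m : ℝ) * j + 1) / (2 * X) := by
    simp only [unit, dir, cond_false, cond_true, one_pow]
    rw [div_mul_div_comm, div_mul_div_comm, e2, ← add_div]
    ring
  rw [e]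
  have hN : (0 : ℝ) < N := by exact_mod_cast (by omega : 0 < N)
  have bound : ∀ a : ℕ, a < N → (a : ℝ) ^ 2 + 1 ≤ N ^ 2 := by
    intro a ha
    have : a ^ 2 + 1 ≤ N ^ 2 := by nlinarith
    exact_mod_cast this
  have hXN : X ^ 2 ≤ (N : ℝ) ^ 4 := by
    rw [hX2, show (N : ℝ) ^ 4 = N ^ 2 * N ^ 2 by ring]
    exact mul_le_mul (bound m hm) (bound j hj) hB.le (by positivity)
  have hd : (1 : ℝ) ≤ ((m : ℝ) - j) ^ 2 := by
    have : (1 : ℤ) ≤ ((m : ℤ) - j) ^ 2 := by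
      have : (m : ℤ) - j ≠ 0 := by omega
      have := sq_pos_of_ne_zero this
      omega
    exact_mod_cast this
  -- Lagrange's identity for `(m, 1)` and `(j, 1)`. Since the right side is at least 1 and the
  -- second factor at most `2 * X`, the first factor is at least `1 / (2 * X)`.
  have hid : (X - (m * j + 1)) * (X + (m * j + 1)) = ((m : ℝ) - j) ^ 2 := by
    ring_nf; rw [hX2]; ring
  have hle : (m : ℝ) * j + 1 ≤ X := by
    have : (0 : ℝ) ≤ (m : ℝ) * j := by positivity
    by_contra hlt
    push Not at hlt
    nlinarith
  have h1 : 1 / (2 * X) ≤ X - (m * j + 1) := by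
    rw [div_le_iff₀ (by positivity)]
    nlinarith
  have h2 : 1 / (4 * (N : ℝ) ^ 4) ≤ 1 / (4 * X ^ 2) := by
    apply one_div_le_one_div_of_le (by positivity); linarith
  have h3 : 1 / (4 * X ^ 2) = 1 / (2 * X) / (2 * X) := by field_simp; norm_num
  have h4 : 1 / (2 * X) / (2 * X) ≤ (X - (m * j + 1)) / (2 * X) := by gcongr
  have h5 : (X - ((m : ℝ) * j + 1)) / (2 * X) = 1 / 2 - (m * j + 1) / (2 * X) := by
    field_simp
  linarith

/-- The score of a key with a query, in `p`-precision arithmetic. -/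
def dotScore (p : ℕ) (u v : Bool → ℝ) : ℝ := rnd p (u false * v false + u true * v true)

theorem abs_dot_sub_le {ε : ℝ} {m j : ℕ} {u v : Bool → ℝ} (hu : Near ε j u) (hv : Near ε m v)
    (hv1 : ∀ s, |v s| ≤ 1) :
    |u false * v false + u true * v true -
      (unit (dir m) false * unit (dir j) false + unit (dir m) true * unit (dir j) true)| ≤
      4 * ε := by
  have key : ∀ s, |u s * v s - unit (dir m) s * unit (dir j) s| ≤ 2 * ε := by
    intro s
    have e : u s * v s - unit (dir m) s * unit (dir j) s =
      (u s - unit (dir j) s) * v s + unit (dir j) s * (v s - unit (dir m) s) := by ring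
    rw [e]
    refine (abs_add_le _ _).trans ?_
    rw [abs_mul, abs_mul]
    have h1 := mul_le_mul (hu s) (hv1 s) (abs_nonneg _) ((abs_nonneg _).trans (hu s))
    have h2 := mul_le_mul (abs_unit_le (dir j) s) (hv s) (abs_nonneg _) zero_le_one
    linarith
  have h0 := key false
  have h1 := key true
  rw [abs_le] at *
  constructor <;> linarith

/-- The key of the position that the query points to has the unique maximal score. -/
theorem dotScore_lt {N p m j : ℕ} (hm : m < N) (hj : j < N) (hne : m ≠ j)
    (hp : 2 ^ 15 * N ^ 4 ≤ 2 ^ p) {u u' v : Bool → ℝ} (hu : Near (512 / 2 ^ p) j u)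
    (hu' : Near (512 / 2 ^ p) m u') (hv : Near (512 / 2 ^ p) m v) (hv1 : ∀ s, |v s| ≤ 1)
    (hu1 : ∀ s, |u s| ≤ 1) (hu1' : ∀ s, |u' s| ≤ 1) :
    dotScore p u v < dotScore p u' v := by
  have h2 : (0 : ℝ) < 2 ^ p := by positivity
  have hN : (0 : ℝ) < (N : ℝ) ^ 4 := by
    have : (0 : ℝ) < N := by exact_mod_cast (by omega : 0 < N)
    positivity
  have hp' : (2 : ℝ) ^ 15 * N ^ 4 ≤ 2 ^ p := by exact_mod_cast hp
  have hN1 : (1 : ℝ) ≤ (N : ℝ) ^ 4 := by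
    have : (1 : ℝ) ≤ N := by exact_mod_cast (by omega : 1 ≤ N)
    exact one_le_pow₀ this
  have a1 := abs_dot_sub_le hu hv hv1
  have a2 := abs_dot_sub_le hu' hv hv1
  have gap := dot_dir_le hm hj hne
  have self := sq_unit_dir m
  have small : ∀ w : Bool → ℝ, (∀ s, |w s| ≤ 1) →
      |w false * v false + w true * v true| ≤ 2 ^ p := by
    intro w hw
    have key : ∀ s, |w s * v s| ≤ 1 := fun s => by
      rw [abs_mul]; exact mul_le_one₀ (hw s) (abs_nonneg _) (hv1 s)
    have := (abs_add_le (w false * v false) (w true * v true)).trans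
      (add_le_add (key false) (key true))
    nlinarith
  have r1 := abs_rnd_sub_le (small u hu1)
  have r2 := abs_rnd_sub_le (small u' hu1')
  -- Each of the two scores is off by at most `4 * 512` units for the errors of the vectors and one
  -- unit for its own rounding, `4098` in all; `2 ^ 15` exceeds `4 * 4098`.
  have g : (4098 : ℝ) / 2 ^ p < 1 / (4 * N ^ 4) := by
    rw [div_lt_div_iff₀ h2 (by positivity)]
    nlinarith
  have e1 : 4 * (512 / (2 : ℝ) ^ p) = 2048 / 2 ^ p := by ring
  have e2 : (4098 : ℝ) / 2 ^ p = 2 * (2048 / 2 ^ p) + 2 * (1 / 2 ^ p) := by ring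
  unfold dotScore
  rw [e1] at a1 a2
  rw [abs_le] at *
  nlinarith

/-- The vector from which a token computes the direction of its own position. -/
def addr (p i : ℕ) (s : Bool) : ℝ :=
  bif s then (if i = 0 then 1 else rnd p (1 / i)) else if i = 0 then 0 else 1

theorem addr_nonneg (p i : ℕ) (s : Bool) : 0 ≤ addr p i s := by
  unfold addr
  cases s
  · simp only [cond_false]; split <;> norm_num
  · simp only [cond_true]
    split
    · norm_num
    · exact rnd_nonneg (by positivity)

/-- Normalization ignores positive factors, and `(1, 1 / i)` is proportional to `(i, 1)`. Rounding
`1 / i` costs one unit of error, because the proportionality factor is at most 1; normalization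
makes it `6 * 1 + 1`. At position 0 the vector `(0, 1)` is exact. -/
theorem near_hat_addr {p : ℕ} (i : ℕ) (hp : 16 ≤ 2 ^ p) : Near (7 / 2 ^ p) i (hat p (addr p i)) := by
  have h2 : (0 : ℝ) < 2 ^ p := by positivity
  have main : ∃ c : ℝ, 0 < c ∧ Near (1 / 2 ^ p) i (fun s => c * addr p i s) := by
    rcases Nat.eq_zero_or_pos i with rfl | hi
    · refine ⟨1 / √2, by positivity, fun s => ?_⟩
      have : 1 / √2 * addr p 0 s - unit (dir 0) s = 0 := by
        cases s <;> simp [addr, unit, dir]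
      rw [this, abs_zero]
      positivity
    · have hi0 : (0 : ℝ) < i := by exact_mod_cast hi
      have hr : 0 < √(2 * ((i : ℝ) ^ 2 + 1)) := Real.sqrt_pos.2 (by positivity)
      have hi1 : (i : ℝ) ≤ √(2 * ((i : ℝ) ^ 2 + 1)) := Real.le_sqrt_of_sq_le (by nlinarith)
      have hc : (i : ℝ) / √(2 * ((i : ℝ) ^ 2 + 1)) ≤ 1 := (div_le_one hr).2 hi1
      refine ⟨i / √(2 * ((i : ℝ) ^ 2 + 1)), by positivity, fun s => ?_⟩
      cases s
      · simp [addr, unit, dir, hi.ne']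
      · have e : (i : ℝ) / √(2 * ((i : ℝ) ^ 2 + 1)) * addr p i true - unit (dir i) true =
            i / √(2 * ((i : ℝ) ^ 2 + 1)) * (rnd p (1 / i) - 1 / i) := by
          simp only [addr, unit, dir, hi.ne', cond_true, cond_false, if_false, one_pow]
          field_simp
        rw [e, abs_mul, abs_of_nonneg (by positivity)]
        have h1 : |(1 : ℝ) / i| ≤ 2 ^ p := by
          rw [abs_of_pos (by positivity)]
          have : (1 : ℝ) ≤ i := by exact_mod_cast hi
          exact ((div_le_one hi0).2 this).trans (one_le_pow₀ (by norm_num))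
        exact (mul_le_mul hc (abs_rnd_sub_le h1) (abs_nonneg _) zero_le_one).trans (one_mul _).le
  obtain ⟨c, hc, h⟩ := main
  have hp' : (16 : ℝ) ≤ 2 ^ p := by exact_mod_cast hp
  have h3 := Near.hat (c := 1) h (by linarith)
  have e : hat p (fun s => c * addr p i s) = hat p (addr p i) := by
    funext s; simp [hat, unit_smul hc]
  rw [e] at h3
  norm_num at h3
  exact h3

end AHAT

/-! ## A machine of attention heads and lookup tables -/

instance : Fintype BoolOp where
  elems := {.and, .or}
  complete := by rintro (_ | _) <;> decide

namespace AHAT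

/-- The registers of a token. -/
inductive Reg : Type
  | one
  | addr (s : Bool)
  | self (s : Bool)
  | cur (s : Bool)
  | qry (d s : Bool)
  | arg (d s : Bool)
  | known (b : Bool)
  | act
  | tmp (src : Option Bool) (b : Bool)
deriving DecidableEq, Fintype

/-- The coordinates that hold truth values. -/
inductive BitIdx : Type
  | value (b : Bool)
  | gate (o : BoolOp)
  | known (b : Bool)
  | act
  | tmp (src : Option Bool) (b : Bool)
  | pos
deriving DecidableEq, Fintype

/-- The pairs of coordinates that hold pointers. -/
inductive PtrIdx : Type
  | slot (d : Bool)
  | addr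
  | self
  | cur
  | qry (d : Bool)
  | arg (d : Bool)
deriving DecidableEq, Fintype

/-- The blocks of the multi-pre-norm. -/
inductive Blk : Type
  | one
  | bit (β : BitIdx)
  | ptr (q : PtrIdx)
deriving DecidableEq, Fintype

/-- The coordinates of the residual stream. -/
abbrev Coord (k : ℕ) : Type := (Slot ⊕ Fin k) ⊕ Fin (Fintype.card Reg)

abbrev Feat : Type := Blk × Bool

variable {k : ℕ}

/-- The coordinate of a register. -/
def reg (r : Reg) : Coord k := .inr (Fintype.equivFin Reg r)

def bitCoord : BitIdx → Coord k
  | .value b => .inl (.inl (.value b))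
  | .gate o => .inl (.inl (.gate o))
  | .known b => reg (.known b)
  | .act => reg .act
  | .tmp src b => reg (.tmp src b)
  | .pos => reg (.addr false)

def ptrCoord : PtrIdx → Bool → Coord k
  | .slot d, s => bif s then reg .one else .inl (.inl (.arg d))
  | .addr, s => reg (.addr s)
  | .self, s => reg (.self s)
  | .cur, s => reg (.cur s)
  | .qry d, s => reg (.qry d s)
  | .arg d, s => reg (.arg d s)

/-- The linear forms of the multi-pre-norm. -/
def form : Blk → Bool → List (ℤ × Coord k)
  | .one, _ => [(1, reg .one)]
  | .bit β, false => [(2, bitCoord β), (-1, reg .one)]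
  | .bit _, true => [(1, reg .one)]
  | .ptr q, s => [(1, ptrCoord q s)]

/-- The features of a residual stream. -/
abbrev fea (p : ℕ) (x : Coord k → ℝ) (f : Feat) : ℝ := feat form p x f

/-- The size of the normalized residual stream. -/
abbrev width : ℕ := Fintype.card (Blk × Bool × Bool)

/-- Write linear forms in the features to the registers. -/
def writeRow (val : Reg → List (ℤ × Feat)) : Coord k → List (ℤ × Feat)
  | .inl _ => []
  | .inr j => val ((Fintype.equivFin Reg).symm j)

/-- An attention head that looks up the position that a pointer points to, or averages all visible
positions, and writes linear forms in the features found there. -/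
structure HeadSpec where
  mask : Mask
  query : Option PtrIdx
  val : Reg → List (ℤ × Feat)

def HeadSpec.queryRow (h : HeadSpec) (s : Bool) : List (ℤ × Feat) :=
  match h.query with
  | none => []
  | some q => [(1, (.ptr q, s))]

/-- The key is always the normalized address. Without a query pointer the query is zero, all scores
tie and attention is uniform. -/
def HeadSpec.toHead (k : ℕ) (h : HeadSpec) : Head width (Coord k) where
  dim := 2
  Q t f := row (relabel featIdx (h.queryRow (finTwoEquiv t))) f
  K t f := row (relabel featIdx [(1, ((.ptr .addr, finTwoEquiv t) : Feat))]) f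
  V c f := row (relabel featIdx (writeRow h.val c)) f
  mask := h.mask

/-- A hidden unit that is zero unless the bits are `a`. -/
def hiddenRow (a : BitIdx → Bool) (f : Feat) : List (ℤ × Feat) :=
  (1, f) :: (-(Fintype.card BitIdx : ℤ), (.one, false)) ::
    (Finset.univ : Finset BitIdx).toList.map fun β => (bif a β then 1 else -1, (.bit β, false))

/-- The assignment and the feature of a hidden unit. -/
def hiddenIdx : (BitIdx → Bool) × Feat ≃ Fin (Fintype.card ((BitIdx → Bool) × Feat)) :=
  Fintype.equivFin _

def hiddenMat : Matrix (Fin (Fintype.card ((BitIdx → Bool) × Feat))) (Fin width) ℝ :=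
  fun h f => row (relabel featIdx (hiddenRow (hiddenIdx.symm h).1 (hiddenIdx.symm h).2)) f

def outMat (out : Reg → (BitIdx → Bool) → List (ℤ × Feat)) :
    Matrix (Coord k) (Fin (Fintype.card ((BitIdx → Bool) × Feat))) ℝ :=
  fun c h => row (writeRow (fun r => out r (hiddenIdx.symm h).1) c) (hiddenIdx.symm h).2

/-- A feedforward network that writes linear forms in the (positive parts of the) features, which
depend on the bits. -/
def tableFFN (out : Reg → (BitIdx → Bool) → List (ℤ × Feat)) : FFN (Coord k) width :=
  .last (Fintype.card ((BitIdx → Bool) × Feat)) hiddenMat (outMat out)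

structure LayerSpec where
  heads : List HeadSpec
  out : Reg → (BitIdx → Bool) → List (ℤ × Feat)

def LayerSpec.toLayer (L : LayerSpec) : Layer (Coord k) where
  attNorm := pairNorm form
  heads := L.heads.map (HeadSpec.toHead k)
  ffnNorm := pairNorm form
  ffn := tableFFN L.out

/-! ### Features -/

theorem weight_form (b : Blk) (s : Bool) : weight (form (k := k) b s) ≤ 3 := by
  cases b <;> cases s <;> simp [form, weight]

theorem weight_form_le {p : ℕ} (hp : 5 ≤ p) (b : Blk) (s : Bool) :
    weight (form (k := k) b s) ≤ 2 ^ p :=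
  (weight_form b s).trans (by
    have : 2 ^ 5 ≤ 2 ^ p := Nat.pow_le_pow_right (by norm_num) hp
    omega)

theorem fea_ptr {p : ℕ} (hp : 5 ≤ p) {x : Coord k → ℝ} (hx : ∀ c, Representable p (x c))
    (q : PtrIdx) (s : Bool) : fea p x (.ptr q, s) = hat p (fun s => x (ptrCoord q s)) s :=
  feat_eq (weight_form_le hp _) (by intro s; simp [form, combo]) (fun s => hx _) s

theorem fea_one {p : ℕ} (hp : 5 ≤ p) {x : Coord k → ℝ} (h1 : x (reg .one) = 1)
    (s : Bool) : fea p x (.one, s) = 1 / 2 := by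
  rw [fea, feat_eq (v := fun _ => 1) (weight_form_le hp _) (by intro s; simp [form, combo, h1])
    (fun s => rnd_one p) s, hat_const (by omega) rfl rfl]

theorem fea_bit {p : ℕ} (hp : 5 ≤ p) {x : Coord k → ℝ} (h1 : x (reg .one) = 1)
    {β : BitIdx} {b : Bool} (hb : x (bitCoord β) = bit b) :
    fea p x (.bit β, false) = bit b - 1 / 2 := by
  rw [fea, feat_eq (v := fun s => bif s then 1 else 2 * bit b - 1)
    (weight_form_le hp _) ?_ ?_, hat_bit (b := b) (by omega)]
  · rfl
  · rfl
  · intro s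
    cases s
    · simp [form, combo, h1, hb]
      ring
    · simp [form, combo, h1]
  · intro s
    cases s
    · cases b
      · simpa [Representable, bit] using rnd_neg_one p
      · have : (2 : ℝ) - 1 = 1 := by norm_num
        simpa [Representable, bit, this] using rnd_one p
    · exact rnd_one p

/-! ### Attention -/

section Attention

variable {N p : ℕ}

/-- The normalized residual streams. -/
abbrev normed (p : ℕ) (x : Fin N → Coord k → ℝ) (j : Fin N) : Fin width → ℝ :=
  (pairNorm form).eval p (x j)

/-- Features are multiples of `2 ^ (-p)` of absolute value at most 1, so an integer form of weight
at most `2 ^ p` is computed without any rounding. -/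
theorem linMap_feat {κ : Type} {W : Matrix κ (Fin width) ℝ} {i : κ} {l : List (ℤ × Feat)}
    (hW : ∀ f, W i f = row (relabel featIdx l) f) (hl : weight l ≤ 2 ^ p)
    (x : Coord k → ℝ) :
    linMap p W ((pairNorm form).eval p x) i = combo l (fea p x) := by
  rw [linMap_row hW (by rwa [weight_relabel]), combo_relabel]
  refine rnd_eq_self (grid_combo fun a _ => grid_feat form p x _) ?_
  exact (abs_combo_le fun f => abs_feat_le form p x f).trans (by exact_mod_cast hl)

theorem HeadSpec.linMap_V (h : HeadSpec) {r : Reg} (hl : weight (h.val r) ≤ 2 ^ p)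
    (x : Coord k → ℝ) :
    linMap p (h.toHead k).V ((pairNorm form).eval p x) (reg r) = combo (h.val r) (fea p x) :=
  linMap_feat (fun f => by simp [HeadSpec.toHead, writeRow, reg]) hl x

theorem HeadSpec.linMap_V_inl (h : HeadSpec) (c : Slot ⊕ Fin k) (x : Coord k → ℝ) :
    linMap p (h.toHead k).V ((pairNorm form).eval p x) (.inl c) = 0 :=
  linMap_feat (l := []) (fun f => by simp [HeadSpec.toHead, writeRow]) (by simp [weight]) x

theorem HeadSpec.eval_inl (h : HeadSpec) (x : Fin N → Coord k → ℝ) (i : Fin N)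
    (c : Slot ⊕ Fin k) : (h.toHead k).eval p (normed p x) i (.inl c) = 0 := by
  simp [Head.eval, normed, HeadSpec.linMap_V_inl, rnd_zero]

theorem HeadSpec.eval_nil (h : HeadSpec) (x : Fin N → Coord k → ℝ) (i : Fin N) {r : Reg}
    (hr : h.val r = []) : (h.toHead k).eval p (normed p x) i (reg r) = 0 := by
  have : ∀ j, linMap p (h.toHead k).V (normed p x j) (reg r) = 0 := fun j => by
    rw [HeadSpec.linMap_V h (by simp [hr, weight])]
    simp [hr, combo]
  simp [Head.eval, this, rnd_zero]

theorem HeadSpec.score_eq (h : HeadSpec) (x : Fin N → Coord k → ℝ) (i j : Fin N) :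
    (h.toHead k).score p (normed p x) i j =
      rnd p (fea p (x j) (.ptr .addr, false) * combo (h.queryRow false) (fea p (x i)) +
        fea p (x j) (.ptr .addr, true) * combo (h.queryRow true) (fea p (x i))) := by
  have h2 : 1 ≤ 2 ^ p := Nat.one_le_two_pow
  have hK : ∀ t, linMap p (h.toHead k).K (normed p x j) t =
      fea p (x j) (.ptr .addr, finTwoEquiv t) := fun t => by
    rw [linMap_feat (l := [(1, ((.ptr .addr, finTwoEquiv t) : Feat))]) (fun f => rfl)
      (by simp [weight, h2])]
    simp [combo]
  have hQ : ∀ t, linMap p (h.toHead k).Q (normed p x i) t =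
      combo (h.queryRow (finTwoEquiv t)) (fea p (x i)) := fun t =>
    linMap_feat (fun f => rfl) (by
      unfold HeadSpec.queryRow; split <;> simp [weight, h2]) _
  unfold Head.score
  simp only [hK, hQ]
  congr 1
  exact Fin.sum_univ_two _

theorem HeadSpec.eval_uniform (h : HeadSpec) (hq : h.query = none)
    (x : Fin N → Coord k → ℝ) (i : Fin N) {r : Reg} (hl : weight (h.val r) ≤ 2 ^ p) :
    (h.toHead k).eval p (normed p x) i (reg r) =
      rnd p ((∑ j ∈ h.mask.visible i, combo (h.val r) (fea p (x j))) /
        (h.mask.visible i).card) := by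
  have e : (h.toHead k).argmax p (normed p x) i = h.mask.visible i := by
    have hs : ∀ j, (h.toHead k).score p (normed p x) i j = 0 := fun j => by
      rw [HeadSpec.score_eq h]
      simp [HeadSpec.queryRow, hq, combo, rnd_zero]
    have hm : (h.toHead k).mask = h.mask := rfl
    ext j
    simp [Head.argmax, hs, hm]
  unfold Head.eval
  rw [e]
  congr 2
  exact Finset.sum_congr rfl fun j _ => HeadSpec.linMap_V h hl _

theorem HeadSpec.eval_lookup (h : HeadSpec) {q : PtrIdx} (hq : h.query = some q)
    (hm : h.mask = .unmasked) (hN : 2 ^ 15 * N ^ 4 ≤ 2 ^ p)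
    (x : Fin N → Coord k → ℝ) (i m : Fin N)
    (hkey : ∀ j : Fin N, Near (512 / 2 ^ p) j fun s => fea p (x j) (.ptr .addr, s))
    (hqry : Near (512 / 2 ^ p) m fun s => fea p (x i) (.ptr q, s))
    {r : Reg} (hl : weight (h.val r) ≤ 2 ^ p) :
    (h.toHead k).eval p (normed p x) i (reg r) = combo (h.val r) (fea p (x m)) := by
  have hs : ∀ j, (h.toHead k).score p (normed p x) i j =
      dotScore p (fun s => fea p (x j) (.ptr .addr, s)) (fun s => fea p (x i) (.ptr q, s)) := by
    intro j
    rw [HeadSpec.score_eq h]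
    simp [HeadSpec.queryRow, hq, combo, dotScore]
  have hlt : ∀ j, j ≠ m → (h.toHead k).score p (normed p x) i j <
      (h.toHead k).score p (normed p x) i m := by
    intro j hj
    rw [hs, hs]
    exact dotScore_lt m.2 j.2 (fun e => hj (Fin.ext e.symm)) hN (hkey j) (hkey m) hqry
      (fun s => abs_feat_le _ _ _ _) (fun s => abs_feat_le _ _ _ _) (fun s => abs_feat_le _ _ _ _)
  have e : (h.toHead k).argmax p (normed p x) i = {m} := by
    ext j
    have hvis : (h.toHead k).mask.visible i = Finset.univ := by
      simp [HeadSpec.toHead, hm, Mask.visible]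
    simp only [Head.argmax, hvis, Finset.mem_filter, Finset.mem_univ, true_and, true_imp_iff,
      Finset.mem_singleton]
    constructor
    · intro hj
      by_contra hne
      exact absurd (hj m) (not_le.2 (hlt j hne))
    · rintro rfl l
      by_cases hl : l = j
      · rw [hl]
      · exact (hlt l hl).le
  unfold Head.eval
  rw [e, Finset.sum_singleton, Finset.card_singleton, Nat.cast_one, div_one,
    HeadSpec.linMap_V h hl]
  refine rnd_eq_self (grid_combo fun a _ => grid_feat form p _ _) ?_
  exact (abs_combo_le fun f => abs_feat_le form p _ f).trans (by exact_mod_cast hl)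

end Attention

/-! ### Lookup tables -/

section Table

variable {p : ℕ}

theorem card_bitIdx : Fintype.card BitIdx = 14 := by decide

theorem weight_hiddenRow (a : BitIdx → Bool) (f : Feat) : weight (hiddenRow a f) = 29 := by
  have h : ∀ l : List BitIdx, weight
      (l.map fun β => ((bif a β then 1 else -1 : ℤ), ((.bit β, false) : Feat))) = l.length := by
    intro l
    induction l with
    | nil => rfl
    | cons b l ih =>
      simp only [weight, List.map_cons, List.sum_cons, List.length_cons] at *
      rw [ih]
      cases a b <;> simp [add_comm]
  have e : weight (hiddenRow a f) = 1 + (14 + weight ((Finset.univ : Finset BitIdx).toList.map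
      fun β => ((bif a β then 1 else -1 : ℤ), ((.bit β, false) : Feat)))) := by
    simp [weight, hiddenRow, card_bitIdx]
  rw [e, h, Finset.length_toList, Finset.card_univ, card_bitIdx]

/-- A bit that agrees with `a` contributes `1 / 2` and one that disagrees `-1 / 2`. The constant
term cancels full agreement, so what is subtracted is the number of disagreements. -/
theorem combo_hiddenRow (a a₀ : BitIdx → Bool) (f : Feat) {z : Feat → ℝ}
    (h1 : z (.one, false) = 1 / 2)
    (hb : ∀ β, z (.bit β, false) = bit (a₀ β) - 1 / 2) :
    combo (hiddenRow a f) z = z f - ∑ β, if a β = a₀ β then 0 else 1 := by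
  have e : combo (hiddenRow a f) z = z f + (-(Fintype.card BitIdx : ℝ) * (1 / 2) +
      ∑ β, (bif a β then 1 else -1 : ℝ) * (bit (a₀ β) - 1 / 2)) := by
    simp only [combo, hiddenRow, List.map_cons, List.sum_cons, List.map_map, Function.comp_def, hb,
      h1]
    rw [Finset.sum_map_toList]
    simp
    exact Finset.sum_congr rfl fun β _ => by cases a β <;> simp
  rw [e]
  have : ∀ β, (bif a β then 1 else -1 : ℝ) * (bit (a₀ β) - 1 / 2) =
      1 / 2 - if a β = a₀ β then 0 else 1 := by
    intro β
    cases a β <;> cases a₀ β <;> norm_num [bit]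
  simp only [this, Finset.sum_sub_distrib, Finset.sum_const, Finset.card_univ, nsmul_eq_mul]
  ring

/-- Features are at most 1, so a single disagreement already switches the unit off. -/
theorem max_hiddenRow (a a₀ : BitIdx → Bool) (f : Feat) {z : Feat → ℝ}
    (h1 : z (.one, false) = 1 / 2) (hz : z f ≤ 1)
    (hb : ∀ β, z (.bit β, false) = bit (a₀ β) - 1 / 2) :
    max 0 (combo (hiddenRow a f) z) = if a = a₀ then max 0 (z f) else 0 := by
  rw [combo_hiddenRow a a₀ f h1 hb]
  split
  · rename_i h; simp [h]
  · rename_i h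
    obtain ⟨β, hβ⟩ := Function.ne_iff.1 h
    have : (1 : ℝ) ≤ ∑ β, if a β = a₀ β then (0 : ℝ) else 1 := by
      have := Finset.single_le_sum (f := fun β => if a β = a₀ β then (0 : ℝ) else 1)
        (fun β _ => by split <;> norm_num) (Finset.mem_univ β)
      simpa [hβ] using this
    exact max_eq_left (by linarith)

theorem tableFFN_eval_inl (out : Reg → (BitIdx → Bool) → List (ℤ × Feat)) (z : Fin width → ℝ)
    (c : Slot ⊕ Fin k) : (tableFFN out).eval p z (.inl c) = 0 := by
  simp [tableFFN, FFN.eval, linMap, outMat, writeRow, row, rnd_zero]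

theorem tableFFN_eval_nil {out : Reg → (BitIdx → Bool) → List (ℤ × Feat)} {r : Reg}
    (h : ∀ a, out r a = []) (z : Fin width → ℝ) :
    (tableFFN (k := k) out).eval p z (reg r) = 0 := by
  simp [tableFFN, FFN.eval, linMap, outMat, writeRow, reg, row, rnd_zero, h]

/-- Only the hidden units of the actual assignment `a₀` survive the ReLU, so the output matrix
reduces to the table entry at `a₀`. -/
theorem tableFFN_eval (hp : 5 ≤ p) {out : Reg → (BitIdx → Bool) → List (ℤ × Feat)} {r : Reg}
    (hl : ∀ a, weight (out r a) ≤ 2 ^ p) {x : Coord k → ℝ} (h1 : x (reg .one) = 1)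
    {a₀ : BitIdx → Bool} (hb : ∀ β, x (bitCoord β) = bit (a₀ β)) :
    (tableFFN (k := k) out).eval p ((pairNorm form).eval p x) (reg r) =
      combo (out r a₀) fun f => max 0 (fea p x f) := by
  have h29 : 29 ≤ 2 ^ p := by
    have : 2 ^ 5 ≤ 2 ^ p := Nat.pow_le_pow_right (by norm_num) hp
    omega
  simp only [tableFFN, FFN.eval]
  have hh : ∀ t, max 0 (linMap p hiddenMat ((pairNorm form).eval p x) t) =
      if (hiddenIdx.symm t).1 = a₀ then max 0 (fea p x (hiddenIdx.symm t).2) else 0 := by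
    intro t
    rw [linMap_feat (l := hiddenRow (hiddenIdx.symm t).1 (hiddenIdx.symm t).2) (fun f => rfl)
      (by rw [weight_hiddenRow]; exact h29)]
    exact max_hiddenRow _ _ _ (fea_one hp h1 false) ((le_abs_self _).trans (abs_feat_le _ _ _ _))
      fun β => fea_bit hp h1 (hb β)
  simp only [hh]
  unfold linMap
  have hc : ∀ h, outMat (k := k) out (reg r) h =
      row (out r (hiddenIdx.symm h).1) (hiddenIdx.symm h).2 := by
    intro h; simp [outMat, writeRow, reg]
  simp only [hc]
  rw [← hiddenIdx.sum_comp]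
  simp only [Equiv.symm_apply_apply, rnd_row (hl _)]
  rw [Fintype.sum_prod_type]
  have : ∀ a : BitIdx → Bool, ∑ f, (row (out r a) f : ℝ) *
      (if a = a₀ then max 0 (fea p x f) else 0) =
      if a = a₀ then combo (out r a₀) (fun f => max 0 (fea p x f)) else 0 := by
    intro a
    split
    · rename_i h; rw [h, sum_row]
    · simp
  simp only [this, Finset.sum_ite_eq', Finset.mem_univ, if_true]
  refine rnd_eq_self (grid_combo fun b _ => ?_) ?_
  · rcases max_choice 0 (fea p x b.2) with e | e <;> rw [e]
    · simpa using grid_int p 0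
    · exact grid_feat _ _ _ _
  · refine (abs_combo_le fun f => ?_).trans (by exact_mod_cast hl a₀)
    have := abs_le.1 (abs_feat_le form p x f)
    rw [abs_of_nonneg (le_max_left _ _)]
    exact max_le zero_le_one this.2

end Table

end AHAT

/-! ## Evaluation of formulas -/

namespace AHAT

open BoolFormula (learns neutral moves)

variable {k : ℕ}

/-! ### The layers -/

/-- Subtract the initial value of a pointer register. -/
def clearPtr (s : Bool) : List (ℤ × Feat) := bif s then [(-2, (.one, false))] else []

/-- Compare with the first token. -/
def layerFirst : LayerSpec where
  heads := [⟨.strictCausal, none, fun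
    | .addr false => [(2, (.one, false))]
    | .addr true => [(-2, (.one, false))]
    | _ => []⟩]
  out _ _ := []

/-- Compute positions, and initialize the pointers and the values of leaves. -/
def layerPosition : LayerSpec where
  heads := [⟨.strictCausal, none, fun
    | .addr true => [(1, (.one, false)), (-1, (.bit .pos, false))]
    | _ => []⟩]
  out
    | .known b, a => bif a (.value b) then [(2, (.one, false))] else []
    | .self s, _ => (1, (.ptr .addr, s)) :: clearPtr s
    | .cur s, _ => (1, (.ptr .addr, s)) :: clearPtr s
    | .qry d s, a =>
      (1, (bif a (.gate .and) || a (.gate .or) then .ptr (.slot d) else .ptr .addr, s)) :: clearPtr s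
    | _, _ => []

/-- A pointer computed from an input slot carries its own rounding errors. The address feature found
at the argument is the canonical key, on which later cancellations rely. -/
def headArg (d : Bool) : HeadSpec :=
  ⟨.unmasked, some (.qry d), fun
    | .arg d' s => bif d' == d then (1, (.ptr .addr, s)) :: clearPtr s else []
    | _ => []⟩

/-- Load the pointers to the arguments. -/
def layerArgs : LayerSpec where
  heads := [headArg false, headArg true]
  out _ _ := []

/-- Bit features are shifted by `-1 / 2`, which the constant feature `1 / 2` undoes. -/
def readBit (b : Bool) : List (ℤ × Feat) := [(1, (.bit (.known b), false)), (1, (.one, false))]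

/-- The address feature of the target is exactly what `cur` holds, so subtracting it erases the old
pointer while the target's pointer is added. The latter arrives with one normalization too many. -/
def headJump : HeadSpec :=
  ⟨.unmasked, some .cur, fun
    | .cur s => [(1, (.ptr .cur, s)), (-1, (.ptr .addr, s))]
    | .tmp none b => readBit b
    | _ => []⟩

def headChild (d : Bool) : HeadSpec :=
  ⟨.unmasked, some (.arg d), fun
    | .tmp src b => bif src == some d then readBit b else []
    | _ => []⟩

/-- One round of the contraction. -/
def layerStep : LayerSpec where
  heads := [headJump, headChild false, headChild true]
  out
    | .known b, a =>
      bif learns (fun o => a (.gate o)) (fun b => a (.known b)) (fun src b => a (.tmp src b)) b &&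
        !a (.known b) then [(2, (.one, false))] else []
    | .act, a =>
      bif (neutral (fun o => a (.gate o)) (fun src b => a (.tmp src b)) false ||
        neutral (fun o => a (.gate o)) (fun src b => a (.tmp src b)) true) && !a .act
        then [(2, (.one, false))] else []
    | .tmp src b, a => bif a (.tmp src b) then [(-2, (.one, false))] else []
    | .cur s, a =>
      match moves (fun o => a (.gate o)) (a .act) (fun src b => a (.tmp src b)) with
      | some d => [(1, (.ptr (.arg d), s)), (-1, (.ptr .self, s))]
      | none => []
    | _, _ => []

/-- At the token that `cur` designates, the feature of `self` equals the over-normalized contents of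
`cur`, and the feature of `addr` is the canonical key; the difference exchanges one for the other
exactly. -/
def headFix : HeadSpec :=
  ⟨.unmasked, some .cur, fun
    | .cur s => [(1, (.ptr .addr, s)), (-1, (.ptr .self, s))]
    | _ => []⟩

/-- Restore the canonical form of the pointers. -/
def layerFix : LayerSpec where
  heads := [headFix]
  out _ _ := []

/-! ### General properties of layers -/

section Layers

variable {N p : ℕ} (L : LayerSpec) (x : Fin N → Coord k → ℝ)

def LayerSpec.att (p : ℕ) (L : LayerSpec) (x : Fin N → Coord k → ℝ) : Fin N → Coord k → ℝ :=
  L.toLayer.attend p x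

def LayerSpec.ff (p : ℕ) (L : LayerSpec) (x : Fin N → Coord k → ℝ) : Fin N → Coord k → ℝ :=
  L.toLayer.feed p x

theorem LayerSpec.att_apply (i : Fin N) (c : Coord k) : L.att p x i c =
    rnd p (x i c + (L.heads.map fun h => (h.toHead k).eval p (normed p x) i c).sum) := by
  simp only [LayerSpec.att, Layer.attend, LayerSpec.toLayer, List.map_map]
  rfl

theorem LayerSpec.ff_apply (i : Fin N) (c : Coord k) : L.ff p x i c =
    rnd p (x i c + (tableFFN L.out).eval p ((pairNorm form).eval p (x i)) c) := rfl

theorem LayerSpec.representable_att (i : Fin N) (c : Coord k) : Representable p (L.att p x i c) :=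
  rnd_rnd _ _

theorem LayerSpec.representable_ff (i : Fin N) (c : Coord k) : Representable p (L.ff p x i c) :=
  rnd_rnd _ _

variable {x}

theorem LayerSpec.att_inl (hx : ∀ i c, Representable p (x i c)) (i : Fin N) (c : Slot ⊕ Fin k) :
    L.att p x i (.inl c) = x i (.inl c) := by
  rw [LayerSpec.att_apply]
  simp only [HeadSpec.eval_inl, List.map_const', List.sum_replicate, smul_zero, add_zero]
  exact hx i _

theorem LayerSpec.ff_inl (hx : ∀ i c, Representable p (x i c)) (i : Fin N) (c : Slot ⊕ Fin k) :
    L.ff p x i (.inl c) = x i (.inl c) := by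
  rw [LayerSpec.ff_apply, tableFFN_eval_inl, add_zero]
  exact hx i _

theorem LayerSpec.att_keep (hx : ∀ i c, Representable p (x i c)) (i : Fin N) {r : Reg}
    (hr : ∀ h ∈ L.heads, h.val r = []) : L.att p x i (reg r) = x i (reg r) := by
  rw [LayerSpec.att_apply]
  have : (L.heads.map fun h => (h.toHead k).eval p (normed p x) i (reg r)).sum = 0 := by
    refine List.sum_eq_zero fun y hy => ?_
    obtain ⟨h, hh, rfl⟩ := List.mem_map.1 hy
    exact HeadSpec.eval_nil h x i (hr h hh)
  rw [this, add_zero]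
  exact hx i _

theorem LayerSpec.ff_keep (hx : ∀ i c, Representable p (x i c)) (i : Fin N) {r : Reg}
    (hr : ∀ a, L.out r a = []) : L.ff p x i (reg r) = x i (reg r) := by
  rw [LayerSpec.ff_apply, tableFFN_eval_nil hr, add_zero]
  exact hx i _

end Layers

/-! ### Contents of the registers -/

/-- The contents of the registers of a token. -/
structure Content where
  addr : Bool → ℝ
  self : Bool → ℝ
  cur : Bool → ℝ
  qry : Bool → Bool → ℝ
  arg : Bool → Bool → ℝ
  known : Bool → Bool
  act : Bool
  tmp : Option Bool → Bool → Bool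

def Content.val (C : Content) : Reg → ℝ
  | .one => 1
  | .addr s => C.addr s
  | .self s => C.self s
  | .cur s => C.cur s
  | .qry d s => C.qry d s
  | .arg d s => C.arg d s
  | .known b => bit (C.known b)
  | .act => bit C.act
  | .tmp src b => bit (C.tmp src b)

def HasContent (x : Coord k → ℝ) (C : Content) : Prop := ∀ r, x (reg r) = C.val r

section Features

variable {p : ℕ} {x : Coord k → ℝ} {C : Content}

theorem HasContent.one (h : HasContent x C) : x (reg .one) = 1 := h .one

theorem HasContent.fea_addr (h : HasContent x C) (hp : 5 ≤ p)
    (hx : ∀ c, Representable p (x c)) (s : Bool) :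
    fea p x (.ptr .addr, s) = hat p C.addr s := by
  rw [fea_ptr hp hx]
  congr 1
  funext s; exact h (.addr s)

theorem HasContent.fea_self (h : HasContent x C) (hp : 5 ≤ p)
    (hx : ∀ c, Representable p (x c)) (s : Bool) :
    fea p x (.ptr .self, s) = hat p C.self s := by
  rw [fea_ptr hp hx]
  congr 1
  funext s; exact h (.self s)

theorem HasContent.fea_cur (h : HasContent x C) (hp : 5 ≤ p)
    (hx : ∀ c, Representable p (x c)) (s : Bool) :
    fea p x (.ptr .cur, s) = hat p C.cur s := by
  rw [fea_ptr hp hx]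
  congr 1
  funext s; exact h (.cur s)

theorem HasContent.fea_qry (h : HasContent x C) (hp : 5 ≤ p)
    (hx : ∀ c, Representable p (x c)) (d s : Bool) :
    fea p x (.ptr (.qry d), s) = hat p (C.qry d) s := by
  rw [fea_ptr hp hx]
  congr 1
  funext s; exact h (.qry d s)

theorem HasContent.fea_arg (h : HasContent x C) (hp : 5 ≤ p)
    (hx : ∀ c, Representable p (x c)) (d s : Bool) :
    fea p x (.ptr (.arg d), s) = hat p (C.arg d) s := by
  rw [fea_ptr hp hx]
  congr 1
  funext s; exact h (.arg d s)

theorem HasContent.readBit (h : HasContent x C) (hp : 5 ≤ p) (b : Bool) :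
    combo (readBit b) (fea p x) = bit (C.known b) := by
  have h1 := fea_bit hp h.one (β := .known b) (h (.known b))
  have h2 := fea_one hp h.one false
  simp only [AHAT.readBit, combo, List.map_cons, List.map_nil, List.sum_cons, List.sum_nil, h1, h2]
  push_cast
  ring

end Features

/-! ### Pointers in registers -/

/-- The canonical pointer to position `i`. -/
def key (p i : ℕ) : Bool → ℝ := hat p (addr p i)

section Key

variable {p : ℕ}

theorem pow_le_pow_prec (hp : 15 ≤ p) : (2 : ℝ) ^ 15 ≤ 2 ^ p :=
  pow_le_pow_right₀ (by norm_num) hp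

/-- Iterating `c ↦ 6 * c + 1` from 1 gives `7`, `43`, `259`. No pointer undergoes more than three
normalizations, so the tolerance `512` of `dotScore_lt` is never exceeded. -/
theorem near_key' (hp : 15 ≤ p) (i : ℕ) : Near (7 / 2 ^ p) i (key p i) := by
  have := pow_le_pow_prec hp
  exact near_hat_addr i (by
    have : 2 ^ 4 ≤ 2 ^ p := Nat.pow_le_pow_right (by norm_num) (by omega)
    omega)

theorem near_hat_key' (hp : 15 ≤ p) (i : ℕ) : Near (43 / 2 ^ p) i (hat p (key p i)) := by
  have := pow_le_pow_prec hp
  have h := (near_key' hp i).hat (by linarith)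
  norm_num at h
  exact h

theorem near_hat_hat_key' (hp : 15 ≤ p) (i : ℕ) :
    Near (259 / 2 ^ p) i (hat p (hat p (key p i))) := by
  have := pow_le_pow_prec hp
  have h := (near_hat_key' hp i).hat (by linarith)
  norm_num at h
  exact h

theorem near_key (hp : 15 ≤ p) (i : ℕ) : Near (512 / 2 ^ p) i (key p i) :=
  (near_key' hp i).mono (by gcongr; norm_num)

theorem near_hat_key (hp : 15 ≤ p) (i : ℕ) : Near (512 / 2 ^ p) i (hat p (key p i)) :=
  (near_hat_key' hp i).mono (by gcongr; norm_num)

theorem near_hat_hat_key (hp : 15 ≤ p) (i : ℕ) :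
    Near (512 / 2 ^ p) i (hat p (hat p (key p i))) :=
  (near_hat_hat_key' hp i).mono (by gcongr; norm_num)

theorem near_hat_hat_dir (hp : 15 ≤ p) (i : ℕ) :
    Near (512 / 2 ^ p) i (hat p (hat p (dir i))) := by
  have := pow_le_pow_prec hp
  exact ((near_hat_dir p i).hat (by linarith)).mono (by gcongr; norm_num)

theorem key_nonneg (p i : ℕ) (s : Bool) : 0 ≤ key p i s := hat_nonneg p (addr_nonneg p i s)

end Key

/-! ### Invariants -/

/-- What holds for all tokens, including those that represent no node. -/
structure Base {N : ℕ} (p : ℕ) (x₀ : Fin N → Slot ⊕ Fin k → ℝ) (x : Fin N → Coord k → ℝ) : Prop where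
  rep : ∀ i c, Representable p (x i c)
  orig : ∀ i c, x i (.inl c) = x₀ i c
  one : ∀ i, x i (reg .one) = 1
  addr : ∀ i s, x i (reg (.addr s)) = addr p i s

section Base

variable {N p : ℕ} {x₀ : Fin N → Slot ⊕ Fin k → ℝ} {x : Fin N → Coord k → ℝ}

theorem Base.att (h : Base p x₀ x) (L : LayerSpec)
    (hL : ∀ h ∈ L.heads, h.val .one = [] ∧ ∀ s, h.val (.addr s) = []) : Base p x₀ (L.att p x) where
  rep i c := L.representable_att x i c
  orig i c := by rw [L.att_inl h.rep, h.orig]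
  one i := by rw [L.att_keep h.rep i fun g hg => (hL g hg).1, h.one]
  addr i s := by rw [L.att_keep h.rep i fun g hg => (hL g hg).2 s, h.addr]

theorem Base.ff (h : Base p x₀ x) (L : LayerSpec)
    (hL : ∀ a, L.out .one a = [] ∧ ∀ s, L.out (.addr s) a = []) : Base p x₀ (L.ff p x) where
  rep i c := L.representable_ff x i c
  orig i c := by rw [L.ff_inl h.rep, h.orig]
  one i := by rw [L.ff_keep h.rep i fun a => (hL a).1, h.one]
  addr i s := by rw [L.ff_keep h.rep i fun a => (hL a).2 s, h.addr]

/-- Tokens that represent no node compete in every unmasked lookup too, so their addresses must be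
right as well. -/
theorem Base.near_key (h : Base p x₀ x) (hp : 15 ≤ p) (j : Fin N) :
    Near (512 / 2 ^ p) j fun s => fea p (x j) (.ptr .addr, s) := by
  have e : (fun s => fea p (x j) (.ptr .addr, s)) = key p j := by
    funext s
    rw [fea_ptr (by omega) (h.rep j), key]
    congr 1
    funext s
    exact h.addr j s
  rw [e]
  exact AHAT.near_key hp j

/-- The bits of a token that represents a node. -/
def bitsOf (ψ : BoolFormula) (π : List Bool) (i : ℕ) (C : Content) : BitIdx → Bool
  | .value b => (BoolFormula.Contraction.start ψ).known π b
  | .gate o => ψ.isGate π o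
  | .known b => C.known b
  | .act => C.act
  | .tmp src b => C.tmp src b
  | .pos => decide (i ≠ 0)

theorem bitCoord_eq {ψ : BoolFormula} {tok : List Bool → Fin N} (h : Base p x₀ x)
    (hψ : Represents x₀ ψ tok) {π : List Bool} (hπ : π ∈ ψ.nodes) {C : Content}
    (hC : HasContent (x (tok π)) C) (β : BitIdx) :
    x (tok π) (bitCoord β) = bit (bitsOf ψ π (tok π) C β) := by
  obtain ⟨φ, hφ⟩ := Option.isSome_iff_exists.1 hπ
  cases β with
  | value b =>
    rw [bitCoord, h.orig]
    cases φ with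
    | leaf c =>
      rw [hψ.leaf_value π c hφ]
      simp [bit, bitsOf, BoolFormula.Contraction.start, hφ, Bool.cond_decide]
    | gate o l r =>
      rw [hψ.gate_value π o l r hφ]
      simp [bit, bitsOf, BoolFormula.Contraction.start, hφ]
  | gate o =>
    rw [bitCoord, h.orig]
    cases φ with
    | leaf c =>
      rw [hψ.leaf_gate π c hφ]
      simp [bit, bitsOf, BoolFormula.isGate, hφ]
    | gate o' l r =>
      rw [hψ.gate_type π o' l r hφ]
      simp [bit, bitsOf, BoolFormula.isGate, hφ, Bool.cond_decide]
  | known b => exact hC (.known b)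
  | act => exact hC .act
  | tmp src b => exact hC (.tmp src b)
  | pos =>
    rw [bitCoord, h.addr]
    by_cases h0 : (tok π : ℕ) = 0 <;> simp [AHAT.addr, bitsOf, bit, h0]

end Base

end AHAT

namespace AHAT

open BoolFormula (learns neutral moves)
open BoolFormula.Contraction (start via step)

variable {k : ℕ}

section Simulation

variable {N p : ℕ} {x₀ : Fin N → Slot ⊕ Fin k → ℝ} {x : Fin N → Coord k → ℝ}

theorem rnd_of_eq {v a : ℝ} (hv : Representable p v) (h : a = v) : rnd p a = v := h ▸ hv

/-- The initial value of a pointer register. -/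
def blank (s : Bool) : ℝ := bif s then 1 else 0

theorem representable_blank (s : Bool) : Representable p (blank s) := by
  cases s
  · exact rnd_zero p
  · exact rnd_one p

theorem representable_key (i : ℕ) (s : Bool) : Representable p (key p i s) :=
  representable_hat _ _ _

theorem representable_addr (i : ℕ) (s : Bool) : Representable p (addr p i s) := by
  cases s
  · simp only [addr, cond_false]; split
    · exact rnd_zero p
    · exact rnd_one p
  · simp only [addr, cond_true]; split
    · exact rnd_one p
    · exact rnd_rnd _ _

def Content.init : Content where
  addr := blank
  self := blank
  cur := blank
  qry _ := blank
  arg _ := blank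
  known _ := false
  act := false
  tmp _ _ := false

theorem le_pow_of_le {n : ℕ} (hp : 5 ≤ p) (hn : n ≤ 4) : n ≤ 2 ^ p := by
  have : 2 ^ 5 ≤ 2 ^ p := Nat.pow_le_pow_right (by norm_num) hp
  omega

theorem card_visible (i : Fin N) : (Mask.strictCausal.visible i).card = (i : ℕ) := by
  simp [Mask.visible, Finset.filter_gt_eq_Iio]

/-! ### Positions -/

/-- The registers before the positions are known. -/
theorem layerFirst_att (hp : 5 ≤ p) (hx : ∀ i c, Representable p (x i c))
    (hC : ∀ i, HasContent (x i) Content.init) (i : Fin N) :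
    HasContent (layerFirst.att p x i) { Content.init with
      addr := fun s => bif s then (if (i : ℕ) = 0 then 1 else 0) else if (i : ℕ) = 0 then 0 else 1 } := by
  intro r
  by_cases hr : ∀ s, r ≠ .addr s
  · rw [layerFirst.att_keep hx i, hC i r]
    · cases r <;> simp_all [Content.val]
    · simp only [layerFirst, List.mem_singleton, forall_eq]
      cases r <;> simp_all
  · push Not at hr
    obtain ⟨s, rfl⟩ := hr
    rw [layerFirst.att_apply, hC i]
    simp only [layerFirst, List.map_cons, List.map_nil, List.sum_cons, List.sum_nil, add_zero]
    rw [HeadSpec.eval_uniform _ rfl _ _ (by cases s <;> exact le_pow_of_le hp (by simp [weight]))]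
    have h1 : ∀ j, fea p (x j) (.one, false) = 1 / 2 := fun j => fea_one hp (hC j).one false
    -- Token 0 sees nothing, its average is 0 and the blank `(0, 1)` remains. All others add the
    -- average of the constant `(1, -1)`.
    rcases Nat.eq_zero_or_pos (i : ℕ) with h0 | h0
    · have hz : Mask.strictCausal.visible i = ∅ := by
        rw [← Finset.card_eq_zero, card_visible, h0]
      simp only [hz, Finset.sum_empty, Finset.card_empty, zero_div, rnd_zero, add_zero]
      cases s
      · simp [Content.val, Content.init, blank, h0, rnd_zero]
      · simp [Content.val, Content.init, blank, h0, rnd_one]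
    · have h0' : (i : ℝ) ≠ 0 := by exact_mod_cast h0.ne'
      cases s
      · simp [combo, h1, card_visible, Content.val, Content.init, blank, h0', h0.ne', rnd_one]
      · simp [combo, h1, card_visible, Content.val, Content.init, blank, h0', h0.ne', rnd_neg_one,
          rnd_zero]

/-- The `i` tokens before token `i` average the indicator of token 0, which is the negation of the
bit `.pos`; the result is `1 / i`. -/
theorem layerPosition_att (hp : 5 ≤ p) (hx : ∀ i c, Representable p (x i c))
    (hC : ∀ i : Fin N, HasContent (x i) { Content.init with
      addr := fun s => bif s then (if (i : ℕ) = 0 then 1 else 0) else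
        if (i : ℕ) = 0 then 0 else 1 }) (i : Fin N) :
    HasContent (layerPosition.att p x i) { Content.init with addr := addr p i } := by
  intro r
  by_cases hr : r ≠ .addr true
  · rw [layerPosition.att_keep hx i, hC i r]
    · cases r <;> simp_all [Content.val, addr]
    · simp only [layerPosition, List.mem_singleton, forall_eq]
  · push Not at hr
    subst hr
    rw [layerPosition.att_apply, hC i]
    simp only [layerPosition, List.map_cons, List.map_nil, List.sum_cons, List.sum_nil, add_zero]
    rw [HeadSpec.eval_uniform _ rfl _ _ (le_pow_of_le hp (by simp [weight]))]
    have h1 : ∀ j, fea p (x j) (.one, false) = 1 / 2 := fun j => fea_one hp (hC j).one false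
    have h2 : ∀ j : Fin N, fea p (x j) (.bit .pos, false) =
        bit (decide ((j : ℕ) ≠ 0)) - 1 / 2 := fun j => by
      refine fea_bit hp (hC j).one ?_
      rw [bitCoord, hC j]
      by_cases h : (j : ℕ) = 0 <;> simp [Content.val, bit, h]
    have h3 : ∀ j : Fin N, combo [((1 : ℤ), ((.one, false) : Feat)), (-1, (.bit .pos, false))]
        (fea p (x j)) = if (j : ℕ) = 0 then 1 else 0 := fun j => by
      by_cases h : (j : ℕ) = 0 <;> simp [combo, h1, h2, h, bit] <;> norm_num
    simp only [h3, card_visible]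
    rcases Nat.eq_zero_or_pos (i : ℕ) with h0 | h0
    · simp [h0, Content.val, addr, rnd_zero, rnd_one]
    · have hs : ∑ j ∈ Mask.strictCausal.visible i, (if (j : ℕ) = 0 then (1 : ℝ) else 0) = 1 := by
        have hN : 0 < N := by have := i.2; omega
        rw [Finset.sum_eq_single (⟨0, hN⟩ : Fin N)]
        · simp
        · intro j _ hj
          rw [if_neg fun h => hj (Fin.ext h)]
        · intro h
          refine absurd ?_ h
          simp only [Mask.visible, Finset.mem_filter, Finset.mem_univ, true_and]
          exact Fin.lt_def.2 h0
      rw [hs]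
      have e : Content.val { Content.init with addr := addr p i } (.addr true) = rnd p (1 / i) := by
        simp only [Content.val, addr, cond_true, if_neg h0.ne']
      rw [e]
      simp only [Content.val, cond_true, if_neg h0.ne', zero_add, rnd_rnd]

/-! ### Nodes -/

variable {ψ : BoolFormula} {tok : List Bool → Fin N}

/-- The registers of a node that hold pointers to its arguments in their first form. -/
def qryVal (p : ℕ) (ψ : BoolFormula) (tok : List Bool → Fin N) (π : List Bool) (d : Bool) :
    Bool → ℝ :=
  bif ψ.isGate π .and || ψ.isGate π .or then hat p (dir (tok (ψ.child π d))) else key p (tok π)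

theorem representable_qryVal (π : List Bool) (d s : Bool) :
    Representable p (qryVal p ψ tok π d s) := by
  unfold qryVal
  cases ψ.isGate π .and || ψ.isGate π .or
  · exact representable_key _ _
  · exact representable_hat _ _ _

/-- At a leaf the input pointers are arbitrary. Its own key replaces them, in accordance with
`child`, so the lookup is meaningful at every node. -/
theorem near_hat_qryVal (hp : 15 ≤ p) {π : List Bool} (hπ : π ∈ ψ.nodes) (d : Bool) :
    Near (512 / 2 ^ p) (tok (ψ.child π d)) (hat p (qryVal p ψ tok π d)) := by
  unfold qryVal
  cases h : ψ.isGate π .and || ψ.isGate π .or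
  swap
  · exact near_hat_hat_dir hp _
  · obtain ⟨φ, hφ⟩ := Option.isSome_iff_exists.1 hπ
    cases φ with
    | leaf c => rw [BoolFormula.Contraction.child_leaf hφ]; exact near_hat_key hp _
    | gate o l r => cases o <;> simp [BoolFormula.isGate, hφ] at h

/-- The registers of the node `π` before the pointers to the arguments are loaded. -/
def nodeInit (p : ℕ) (ψ : BoolFormula) (tok : List Bool → Fin N) (π : List Bool) : Content where
  addr := addr p (tok π)
  self := key p (tok π)
  cur := key p (tok π)
  qry := qryVal p ψ tok π
  arg _ := blank
  known := (start ψ).known π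
  act := false
  tmp _ _ := false

/-- The registers of the node `π` in the state `S` of the contraction. -/
def nodeContent (p : ℕ) (ψ : BoolFormula) (tok : List Bool → Fin N)
    (S : BoolFormula.Contraction) (π : List Bool) : Content where
  addr := addr p (tok π)
  self := key p (tok π)
  cur := key p (tok (S.ptr π))
  qry := qryVal p ψ tok π
  arg d := key p (tok (ψ.child π d))
  known := S.known π
  act := S.active π
  tmp _ _ := false

theorem representable_nodeContent (S : BoolFormula.Contraction) (π : List Bool) (r : Reg) :
    Representable p ((nodeContent p ψ tok S π).val r) := by
  cases r with
  | one => exact rnd_one p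
  | addr s => exact representable_addr _ _
  | self s => exact representable_key _ _
  | cur s => exact representable_key _ _
  | qry d s =>
    exact representable_qryVal π d s
  | arg d s => exact representable_key _ _
  | known b => exact representable_bit _ _
  | act => exact representable_bit _ _
  | tmp src b => exact representable_bit _ _

theorem representable_nodeInit (π : List Bool) (r : Reg) :
    Representable p ((nodeInit p ψ tok π).val r) := by
  cases r with
  | one => exact rnd_one p
  | addr s => exact representable_addr _ _
  | self s => exact representable_key _ _
  | cur s => exact representable_key _ _
  | qry d s =>
    exact representable_qryVal π d s
  | arg d s => exact representable_blank _
  | known b => exact representable_bit _ _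
  | act => exact representable_bit _ _
  | tmp src b => exact representable_bit _ _

theorem ff_apply_node (hp : 5 ≤ p) (L : LayerSpec) (hB : Base p x₀ x) (hψ : Represents x₀ ψ tok)
    {π : List Bool} (hπ : π ∈ ψ.nodes) {C : Content} (hC : HasContent (x (tok π)) C) {r : Reg}
    (hl : ∀ a, weight (L.out r a) ≤ 4) :
    L.ff p x (tok π) (reg r) = rnd p (C.val r +
      combo (L.out r (bitsOf ψ π (tok π) C)) fun f => max 0 (fea p (x (tok π)) f)) := by
  rw [L.ff_apply, tableFFN_eval hp (fun a => le_pow_of_le hp (hl a)) hC.one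
    (bitCoord_eq hB hψ hπ hC), hC]

theorem combo_clearPtr {z : Feat → ℝ} (hz : z (.one, false) = 1 / 2) (s : Bool) :
    combo (clearPtr s) z = -blank s := by
  cases s <;> simp [clearPtr, combo, blank, hz]

theorem combo_cons {F : Type} (a : ℤ × F) (l : List (ℤ × F)) (z : F → ℝ) :
    combo (a :: l) z = a.1 * z a.2 + combo l z := by
  simp [combo]

theorem combo_nil {F : Type} (z : F → ℝ) : combo [] z = 0 := by
  simp [combo]

theorem weight_clearPtr (s : Bool) : weight (clearPtr s) ≤ 2 := by
  cases s <;> simp [clearPtr, weight]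

theorem weight_cons {F : Type} (a : ℤ × F) (l : List (ℤ × F)) :
    weight (a :: l) = a.1.natAbs + weight l := by
  simp [weight]

theorem weight_layerPosition (r : Reg) (a : BitIdx → Bool) :
    weight (layerPosition.out r a) ≤ 4 := by
  cases r with
  | known b => cases h : a (.value b) <;> simp [layerPosition, weight, h]
  | self s | cur s | qry d s =>
    have := weight_clearPtr s
    simp only [layerPosition, weight_cons]
    simpa using by omega
  | _ => simp [layerPosition, weight]

theorem weight_headArg (d : Bool) (r : Reg) : weight ((headArg d).val r) ≤ 4 := by
  cases r with
  | arg d' s =>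
    have := weight_clearPtr s
    cases h : d' == d <;> simp only [headArg, h, cond_true, cond_false, weight_cons]
    · simp [weight]
    · simpa using by omega
  | _ => simp [headArg, weight]

theorem weight_headJump (r : Reg) : weight (headJump.val r) ≤ 4 := by
  cases r with
  | tmp src b => cases src <;> simp [headJump, readBit, weight]
  | _ => simp [headJump, weight]

theorem weight_headChild (d : Bool) (r : Reg) : weight ((headChild d).val r) ≤ 4 := by
  cases r with
  | tmp src b => cases h : src == some d <;> simp [headChild, readBit, weight, h]
  | _ => simp [headChild, weight]

theorem weight_layerStep (r : Reg) (a : BitIdx → Bool) : weight (layerStep.out r a) ≤ 4 := by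
  have key : ∀ (c : Bool) (l : List (ℤ × Feat)), weight l ≤ 4 →
      weight (bif c then l else []) ≤ 4 := by
    intro c l h
    cases c
    · simp [weight]
    · exact h
  cases r with
  | known b => exact key _ _ (by simp [weight])
  | act => exact key _ _ (by simp [weight])
  | tmp src b => exact key _ _ (by simp [weight])
  | cur s =>
    simp only [layerStep]
    split <;> simp [weight]
  | _ => simp [layerStep, weight]

theorem weight_headFix (r : Reg) : weight (headFix.val r) ≤ 4 := by
  cases r <;> simp [headFix, weight]

/-- Pairing the stored position with the constant register produces `(m, 1)`, so one normalization
turns a number into a direction. -/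
theorem fea_slot (hp : 5 ≤ p) (hB : Base p x₀ x) (hψ : Represents x₀ ψ tok)
    {π : List Bool} {o : BoolOp} {l r : BoolFormula} (hφ : ψ.subAt π = some (.gate o l r))
    (d s : Bool) : fea p (x (tok π)) (.ptr (.slot d), s) = hat p (dir (tok (ψ.child π d))) s := by
  rw [fea_ptr hp (hB.rep _)]
  congr 1
  funext s
  cases s
  · simp [ptrCoord, hB.orig, hψ.gate_arg π o l r hφ, dir, BoolFormula.Contraction.child_gate hφ]
  · simp [ptrCoord, hB.one, dir]

theorem dir_nonneg (m : ℕ) (s : Bool) : 0 ≤ dir m s := by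
  cases s <;> simp [dir]

theorem layerPosition_ff (hp : 5 ≤ p) (hB : Base p x₀ x) (hψ : Represents x₀ ψ tok)
    {π : List Bool} (hπ : π ∈ ψ.nodes)
    (hC : HasContent (x (tok π)) { Content.init with addr := addr p (tok π) }) :
    HasContent (layerPosition.ff p x (tok π)) (nodeInit p ψ tok π) := by
  intro r
  have h1 : max 0 (fea p (x (tok π)) (.one, false)) = 1 / 2 := by
    rw [fea_one hp hC.one]; norm_num
  -- The table sees only positive parts of features, and pointers lose nothing because their
  -- coordinates are nonnegative.
  have h2 : ∀ s, max 0 (fea p (x (tok π)) (.ptr .addr, s)) = key p (tok π) s := fun s => by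
    rw [hC.fea_addr hp (hB.rep _)]
    exact max_eq_right (key_nonneg _ _ _)
  rw [ff_apply_node hp layerPosition hB hψ hπ hC (weight_layerPosition r)]
  have hc : ∀ s, combo (clearPtr s) (fun f => max 0 (fea p (x (tok π)) f)) = -blank s :=
    combo_clearPtr (z := fun f => max 0 (fea p (x (tok π)) f)) h1
  have hrep := representable_nodeInit (p := p) (ψ := ψ) (tok := tok) π r
  refine rnd_of_eq hrep ?_
  cases r with
  | self s =>
    simp only [layerPosition, combo_cons, hc, h2]
    simp [Content.val, Content.init, nodeInit]
  | cur s =>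
    simp only [layerPosition, combo_cons, hc, h2]
    simp [Content.val, Content.init, nodeInit]
  | qry d s =>
    change blank s + combo ((1, (bif ψ.isGate π .and || ψ.isGate π .or then .ptr (.slot d) else
      .ptr .addr, s)) :: clearPtr s) _ = qryVal p ψ tok π d s
    unfold qryVal
    cases h : ψ.isGate π .and || ψ.isGate π .or
    · simp only [cond_false, combo_cons, hc, h2]
      simp
    · obtain ⟨φ, hφ⟩ := Option.isSome_iff_exists.1 hπ
      cases φ with
      | leaf c => simp [BoolFormula.isGate, hφ] at h
      | gate o l r =>
        simp only [cond_true, combo_cons, hc]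
        rw [fea_slot hp hB hψ hφ, max_eq_right (hat_nonneg _ (dir_nonneg _ _))]
        simp
  | known b =>
    change (0 : ℝ) + combo (bif (start ψ).known π b then _ else _) _ = bit ((start ψ).known π b)
    cases (start ψ).known π b <;> simp [combo, bit, h1]
  | _ => simp [layerPosition, combo_nil, Content.val, nodeInit, Content.init]

theorem layerArgs_att (hp : 15 ≤ p) (hN : 2 ^ 15 * N ^ 4 ≤ 2 ^ p) (hB : Base p x₀ x)
    (hC : ∀ π ∈ ψ.nodes, HasContent (x (tok π)) (nodeInit p ψ tok π))
    {π : List Bool} (hπ : π ∈ ψ.nodes) :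
    HasContent (layerArgs.att p x (tok π)) (nodeContent p ψ tok (start ψ) π) := by
  have hp5 : 5 ≤ p := by omega
  intro r
  have hl := fun d => le_pow_of_le hp5 (weight_headArg d r)
  have hv : ∀ d, ((headArg d).toHead k).eval p (normed p x) (tok π) (reg r) =
      combo ((headArg d).val r) (fea p (x (tok (ψ.child π d)))) := fun d => by
    refine HeadSpec.eval_lookup (headArg d) rfl rfl hN x _ _ (hB.near_key hp) ?_ (hl d)
    have := near_hat_qryVal (tok := tok) hp hπ d
    have e : (fun s => fea p (x (tok π)) (.ptr (.qry d), s)) = hat p (qryVal p ψ tok π d) := by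
      funext s; exact (hC π hπ).fea_qry hp5 (hB.rep _) d s
    rwa [e]
  rw [layerArgs.att_apply, hC π hπ]
  simp only [layerArgs, List.map_cons, List.map_nil, List.sum_cons, List.sum_nil, add_zero, hv]
  have h1 : ∀ j, fea p (x j) (.one, false) = 1 / 2 := fun j => fea_one hp5 (hB.one j) false
  have h2 : ∀ d s, fea p (x (tok (ψ.child π d))) (.ptr .addr, s) = key p (tok (ψ.child π d)) s :=
    fun d s => (hC _ (BoolFormula.Contraction.child_mem hπ d)).fea_addr hp5 (hB.rep _) s
  refine rnd_of_eq (representable_nodeContent (ψ := ψ) (start ψ) π r) ?_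
  cases r with
  | arg d s =>
    cases d <;> simp [headArg, combo_cons, combo_nil, combo_clearPtr (h1 _), h2, Content.val,
      nodeInit, nodeContent]
  | _ => simp [headArg, combo_nil, Content.val, nodeInit, nodeContent, start]

/-! ### One round -/

variable {S : BoolFormula.Contraction}

/-- The registers of the node `π` after reading the tokens it points to. -/
def nodeRead (p : ℕ) (ψ : BoolFormula) (tok : List Bool → Fin N)
    (S : BoolFormula.Contraction) (π : List Bool) : Content :=
  { nodeContent p ψ tok S π with
    cur := hat p (key p (tok (S.ptr (S.ptr π))))
    tmp := via ψ S π }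

/-- The registers of the node `π` before the pointer is brought to its canonical form. -/
def nodeStep (p : ℕ) (ψ : BoolFormula) (tok : List Bool → Fin N)
    (S : BoolFormula.Contraction) (π : List Bool) : Content :=
  { nodeContent p ψ tok (step ψ S) π with
    cur := hat p (key p (tok ((step ψ S).ptr π))) }

/-- The target and the arguments of a node are nodes again, so what is read there is known exactly.
All heads read the state before the round, as the simultaneous update of `step` demands. -/
theorem layerStep_att (hp : 15 ≤ p) (hN : 2 ^ 15 * N ^ 4 ≤ 2 ^ p) (hB : Base p x₀ x)
    (hS : S.Sound ψ) (hC : ∀ π ∈ ψ.nodes, HasContent (x (tok π)) (nodeContent p ψ tok S π))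
    {π : List Bool} (hπ : π ∈ ψ.nodes) :
    HasContent (layerStep.att p x (tok π)) (nodeRead p ψ tok S π) := by
  have hp5 : 5 ≤ p := by omega
  intro r
  have hlj := le_pow_of_le hp5 (weight_headJump r)
  have hlc := fun d => le_pow_of_le hp5 (weight_headChild d r)
  have hvj : (headJump.toHead k).eval p (normed p x) (tok π) (reg r) =
      combo (headJump.val r) (fea p (x (tok (S.ptr π)))) := by
    refine HeadSpec.eval_lookup headJump rfl rfl hN x _ _ (hB.near_key hp) ?_ hlj
    have e : (fun s => fea p (x (tok π)) (.ptr .cur, s)) = hat p (key p (tok (S.ptr π))) := by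
      funext s; exact (hC π hπ).fea_cur hp5 (hB.rep _) s
    rw [e]
    exact near_hat_key hp _
  have hvc : ∀ d, ((headChild d).toHead k).eval p (normed p x) (tok π) (reg r) =
      combo ((headChild d).val r) (fea p (x (tok (ψ.child π d)))) := fun d => by
    refine HeadSpec.eval_lookup (headChild d) rfl rfl hN x _ _ (hB.near_key hp) ?_ (hlc d)
    have e : (fun s => fea p (x (tok π)) (.ptr (.arg d), s)) =
        hat p (key p (tok (ψ.child π d))) := by
      funext s; exact (hC π hπ).fea_arg hp5 (hB.rep _) d s
    rw [e]
    exact near_hat_key hp _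
  rw [layerStep.att_apply, hC π hπ]
  simp only [layerStep, List.map_cons, List.map_nil, List.sum_cons, List.sum_nil, add_zero, hvj,
    hvc]
  have hq := hS.ptr_mem π hπ
  have h2 : ∀ s, fea p (x (tok (S.ptr π))) (.ptr .addr, s) = key p (tok (S.ptr π)) s :=
    fun s => (hC _ hq).fea_addr hp5 (hB.rep _) s
  have h3 : ∀ s, fea p (x (tok (S.ptr π))) (.ptr .cur, s) =
      hat p (key p (tok (S.ptr (S.ptr π)))) s :=
    fun s => (hC _ hq).fea_cur hp5 (hB.rep _) s
  have h4 : ∀ b, combo (readBit b) (fea p (x (tok (S.ptr π)))) = bit (S.known (S.ptr π) b) :=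
    fun b => (hC _ hq).readBit hp5 b
  have h5 : ∀ d b, combo (readBit b) (fea p (x (tok (ψ.child π d)))) =
      bit (S.known (ψ.child π d) b) :=
    fun d b => (hC _ (BoolFormula.Contraction.child_mem hπ d)).readBit hp5 b
  have hrep := representable_nodeContent (p := p) (tok := tok) (ψ := ψ) S π r
  cases r with
  | cur s =>
    refine rnd_of_eq (representable_hat _ _ _) ?_
    simp [headJump, headChild, combo_cons, combo_nil, h2, h3, Content.val, nodeContent, nodeRead]
  | tmp src b =>
    refine rnd_of_eq (representable_bit _ _) ?_
    rcases src with _ | _ | _ <;>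
      simp [headJump, headChild, combo_nil, h4, h5, Content.val, nodeContent, nodeRead, via,
        bit_false]
  | _ =>
    refine rnd_of_eq hrep ?_
    simp [headJump, headChild, combo_nil, Content.val, nodeRead]

theorem layerStep_ff (hp : 5 ≤ p) (hB : Base p x₀ x) (hψ : Represents x₀ ψ tok) (hS : S.Sound ψ)
    {π : List Bool} (hπ : π ∈ ψ.nodes) (hC : HasContent (x (tok π)) (nodeRead p ψ tok S π)) :
    HasContent (layerStep.ff p x (tok π)) (nodeStep p ψ tok S π) := by
  intro r
  have h1 : max 0 (fea p (x (tok π)) (.one, false)) = 1 / 2 := by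
    rw [fea_one hp hC.one]; norm_num
  have h2 : ∀ s, max 0 (fea p (x (tok π)) (.ptr .self, s)) = hat p (key p (tok π)) s := fun s => by
    rw [hC.fea_self hp (hB.rep _)]
    exact max_eq_right (hat_nonneg _ (key_nonneg _ _ _))
  have h3 : ∀ d s, max 0 (fea p (x (tok π)) (.ptr (.arg d), s)) =
      hat p (key p (tok (ψ.child π d))) s := fun d s => by
    rw [hC.fea_arg hp (hB.rep _)]
    exact max_eq_right (hat_nonneg _ (key_nonneg _ _ _))
  rw [ff_apply_node hp layerStep hB hψ hπ hC (weight_layerStep r)]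
  have hrep := representable_nodeContent (p := p) (tok := tok) (ψ := ψ) (step ψ S) π r
  cases r with
  | cur s =>
    refine rnd_of_eq (representable_hat _ _ _) ?_
    change hat p (key p (tok (S.ptr (S.ptr π)))) s + combo (match moves (ψ.isGate π) (S.active π)
      (via ψ S π) with
      | some d => [((1 : ℤ), ((.ptr (.arg d), s) : Feat)), (-1, (.ptr .self, s))]
      | none => []) _ = hat p (key p (tok (match moves (ψ.isGate π) (S.active π) (via ψ S π) with
        | some d => ψ.child π d
        | none => S.ptr (S.ptr π)))) s
    rcases hm : moves (ψ.isGate π) (S.active π) (via ψ S π) with _ | d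
    · simp [combo_nil]
    -- Only an inactive node moves. Its pointer led to itself, so `cur` now holds its own normalized
    -- key, precisely the `self` feature that is subtracted.
    · have ha : S.active π ≠ true := by
        intro ha
        simp [moves, ha] at hm
      have hptr : S.ptr π = π := by
        by_contra hne
        exact ha ((hS.active π hπ).2 hne)
      simp [combo_cons, combo_nil, h2, h3, hptr]
  | known b =>
    refine rnd_of_eq (representable_bit _ _) ?_
    change bit (S.known π b) + combo (bif learns (ψ.isGate π) (S.known π) (via ψ S π) b &&
      !S.known π b then _ else _) _ = bit (learns (ψ.isGate π) (S.known π) (via ψ S π) b)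
    -- The table adds 1 only where the bit is not yet set, so it never becomes 2; this needs that
    -- known values stay known.
    have hk : S.known π b = true → learns (ψ.isGate π) (S.known π) (via ψ S π) b = true := by
      intro h; simp [learns, h]
    cases h : S.known π b
    · cases h' : learns (ψ.isGate π) (S.known π) (via ψ S π) b <;> simp [combo, bit, h1]
    · simp [combo, hk h]
  | act =>
    refine rnd_of_eq (representable_bit _ _) ?_
    change bit (S.active π) + combo (bif (neutral (ψ.isGate π) (via ψ S π) false ||
      neutral (ψ.isGate π) (via ψ S π) true) && !S.active π then _ else _) _ =
      bit (S.active π || neutral (ψ.isGate π) (via ψ S π) false ||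
        neutral (ψ.isGate π) (via ψ S π) true)
    cases S.active π <;> cases neutral (ψ.isGate π) (via ψ S π) false <;>
      cases neutral (ψ.isGate π) (via ψ S π) true <;> simp [combo, bit, h1]
  | tmp src b =>
    refine rnd_of_eq (representable_bit _ _) ?_
    change bit (via ψ S π src b) + combo (bif via ψ S π src b then _ else _) _ = 0
    cases via ψ S π src b <;> simp [combo, bit, h1]
  | _ =>
    refine rnd_of_eq hrep ?_
    simp [layerStep, combo_nil, Content.val, nodeRead, nodeStep, nodeContent]

/-- The query is an address normalized three times, still accurate enough to find its token; the
exact cancellation there resets the error, so it does not grow with the number of rounds. -/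
theorem layerFix_att (hp : 15 ≤ p) (hN : 2 ^ 15 * N ^ 4 ≤ 2 ^ p) (hB : Base p x₀ x)
    (hS : S.Sound ψ) (hC : ∀ π ∈ ψ.nodes, HasContent (x (tok π)) (nodeStep p ψ tok S π))
    {π : List Bool} (hπ : π ∈ ψ.nodes) :
    HasContent (layerFix.att p x (tok π)) (nodeContent p ψ tok (step ψ S) π) := by
  have hp5 : 5 ≤ p := by omega
  intro r
  have hl := le_pow_of_le hp5 (weight_headFix r)
  have hv : (headFix.toHead k).eval p (normed p x) (tok π) (reg r) =
      combo (headFix.val r) (fea p (x (tok ((step ψ S).ptr π)))) := by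
    refine HeadSpec.eval_lookup headFix rfl rfl hN x _ _ (hB.near_key hp) ?_ hl
    have e : (fun s => fea p (x (tok π)) (.ptr .cur, s)) =
        hat p (hat p (key p (tok ((step ψ S).ptr π)))) := by
      funext s; exact (hC π hπ).fea_cur hp5 (hB.rep _) s
    rw [e]
    exact near_hat_hat_key hp _
  rw [layerFix.att_apply, hC π hπ]
  simp only [layerFix, List.map_cons, List.map_nil, List.sum_cons, List.sum_nil, add_zero, hv]
  have hq := hS.step.ptr_mem π hπ
  have h2 : ∀ s, fea p (x (tok ((step ψ S).ptr π))) (.ptr .addr, s) =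
      key p (tok ((step ψ S).ptr π)) s :=
    fun s => (hC _ hq).fea_addr hp5 (hB.rep _) s
  have h3 : ∀ s, fea p (x (tok ((step ψ S).ptr π))) (.ptr .self, s) =
      hat p (key p (tok ((step ψ S).ptr π))) s :=
    fun s => (hC _ hq).fea_self hp5 (hB.rep _) s
  refine rnd_of_eq (representable_nodeContent (p := p) (tok := tok) (ψ := ψ) (step ψ S) π r) ?_
  cases r with
  | cur s => simp [headFix, combo_cons, combo_nil, h2, h3, Content.val, nodeContent, nodeStep]
  | _ => simp [headFix, combo_nil, Content.val, nodeStep]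

end Simulation

end AHAT

namespace AHAT

open BoolFormula.Contraction (start step iter iter_succ sound_iter known_iff)

/-! ### The transformer -/

/-- The number of rounds. -/
def rounds (n : ℕ) : ℕ := 4 * (Nat.log 2 n + 1) + 1

/-- The precision, for numbers that are given with precision `q`. -/
def precision (q : ℕ → ℕ) (n : ℕ) : ℕ := 4 * (Nat.log 2 n + 1) + 15 + q n

/-- The layers that prepare the contraction. -/
def initialBlock (k : ℕ) : List (Layer (Coord k)) :=
  [layerFirst.toLayer, layerPosition.toLayer, layerArgs.toLayer]

/-- The layers that perform one round of the contraction. -/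
def loopedBlock (k : ℕ) : List (Layer (Coord k)) := [layerStep.toLayer, layerFix.toLayer]

/-- The transformer that evaluates formulas. -/
def evaluator (k : ℕ) (q : ℕ → ℕ) : LoopedTransformer (Coord k) where
  initial := initialBlock k
  looped := loopedBlock k
  final := []
  loops := rounds
  prec := precision q

/-- The initial values of the registers. -/
def initVec (j : Fin (Fintype.card Reg)) : ℝ := Content.init.val ((Fintype.equivFin Reg).symm j)

/-! ### Logarithmic growth of the number of rounds and of the precision -/

theorem isOLog_const (c : ℕ) : IsOLog fun _ => c :=
  (Real.isLittleO_const_log_atTop.comp_tendsto tendsto_natCast_atTop_atTop).isBigO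

theorem IsOLog.add {f g : ℕ → ℕ} (hf : IsOLog f) (hg : IsOLog g) : IsOLog fun n => f n + g n := by
  simpa [IsOLog] using IsBigO.add hf hg

theorem isOLog_log : IsOLog fun n => Nat.log 2 n := by
  refine IsBigO.of_bound (1 / Real.log 2) (Eventually.of_forall fun n => ?_)
  have h2 : 0 < Real.log 2 := Real.log_pos (by norm_num)
  have h := Real.natLog_le_logb n 2
  rw [Real.norm_of_nonneg (by positivity), Real.norm_of_nonneg (Real.log_natCast_nonneg n)]
  refine h.trans (le_of_eq ?_)
  rw [Real.logb]
  push_cast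
  ring

theorem isOLog_four_mul_log (c : ℕ) : IsOLog fun n => 4 * (Nat.log 2 n + 1) + c := by
  have h := isOLog_log.add (isOLog_const 1)
  refine IsOLog.add ?_ (isOLog_const c)
  have := IsBigO.const_mul_left h 4
  simpa [IsOLog] using this

/-! ### Invariants along a run of the transformer -/

section Run

variable {k N p : ℕ} {x₀ : Fin N → Slot ⊕ Fin k → ℝ} {x : Fin N → Coord k → ℝ}
  {ψ : BoolFormula} {tok : List Bool → Fin N}

theorem ff_content {L : LayerSpec} (hL : ∀ r a, L.out r a = []) (hx : ∀ i c, Representable p (x i c))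
    {i : Fin N} {C : Content} (hC : HasContent (x i) C) : HasContent (L.ff p x i) C := fun r => by
  rw [L.ff_keep hx i (hL r), hC]

/-- What holds after the initial block. -/
theorem initial_spec (hp : 15 ≤ p) (hN : 2 ^ 15 * N ^ 4 ≤ 2 ^ p)
    (hx : ∀ i c, Representable p (x i c)) (horig : ∀ i c, x i (.inl c) = x₀ i c)
    (hC : ∀ i, HasContent (x i) Content.init) (hψ : Represents x₀ ψ tok) :
    Base p x₀ (runBlock p (initialBlock k) x) ∧ ∀ π ∈ ψ.nodes,
      HasContent (runBlock p (initialBlock k) x (tok π))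
        (nodeContent p ψ tok (start ψ) π) := by
  have hp5 : 5 ≤ p := by omega
  set y := layerFirst.ff p (layerFirst.att p x) with hy
  have y1 : ∀ i c, Representable p (y i c) := fun i c => layerFirst.representable_ff _ i c
  have y2 : ∀ i c, y i (.inl c) = x₀ i c := fun i c => by
    rw [hy, layerFirst.ff_inl (layerFirst.representable_att x), layerFirst.att_inl hx, horig]
  have y3 := fun i => ff_content (L := layerFirst) (fun _ _ => rfl)
    (layerFirst.representable_att x) (layerFirst_att hp5 hx hC i)
  set z := layerPosition.att p y with hz
  have z1 := layerPosition_att hp5 y1 y3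
  have z2 : Base p x₀ z :=
    { rep := layerPosition.representable_att y
      orig := fun i c => by rw [hz, layerPosition.att_inl y1, y2]
      one := fun i => z1 i .one
      addr := fun i s => z1 i (.addr s) }
  set w := layerPosition.ff p z with hw
  have w1 : Base p x₀ w := z2.ff layerPosition fun a => ⟨rfl, fun s => rfl⟩
  have w2 : ∀ π ∈ ψ.nodes, HasContent (w (tok π)) (nodeInit p ψ tok π) := fun π hπ =>
    layerPosition_ff hp5 z2 hψ hπ (z1 _)
  have v1 : Base p x₀ (layerArgs.att p w) := w1.att layerArgs (by
    simp only [layerArgs, List.mem_cons, List.not_mem_nil, or_false]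
    rintro h (rfl | rfl) <;> exact ⟨rfl, fun s => rfl⟩)
  have v2 : ∀ π ∈ ψ.nodes, HasContent (layerArgs.att p w (tok π))
      (nodeContent p ψ tok (start ψ) π) := fun π hπ => layerArgs_att hp hN w1 w2 hπ
  exact ⟨v1.ff layerArgs fun a => ⟨rfl, fun s => rfl⟩, fun π hπ =>
    ff_content (fun _ _ => rfl) v1.rep (v2 π hπ)⟩

/-- The looped block performs one round of the contraction. -/
theorem looped_spec (hp : 15 ≤ p) (hN : 2 ^ 15 * N ^ 4 ≤ 2 ^ p) (hψ : Represents x₀ ψ tok)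
    {S : BoolFormula.Contraction} (hS : S.Sound ψ) (hB : Base p x₀ x)
    (hC : ∀ π ∈ ψ.nodes, HasContent (x (tok π)) (nodeContent p ψ tok S π)) :
    Base p x₀ (runBlock p (loopedBlock k) x) ∧ ∀ π ∈ ψ.nodes,
      HasContent (runBlock p (loopedBlock k) x (tok π))
        (nodeContent p ψ tok (step ψ S) π) := by
  have hp5 : 5 ≤ p := by omega
  have y1 : Base p x₀ (layerStep.att p x) := hB.att layerStep (by
    simp only [layerStep, List.mem_cons, List.not_mem_nil, or_false]
    rintro h (rfl | rfl | rfl) <;> exact ⟨rfl, fun s => rfl⟩)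
  have z1 : Base p x₀ (layerStep.ff p (layerStep.att p x)) :=
    y1.ff layerStep fun a => ⟨rfl, fun s => rfl⟩
  have z2 : ∀ π ∈ ψ.nodes, HasContent (layerStep.ff p (layerStep.att p x) (tok π))
      (nodeStep p ψ tok S π) := fun π hπ =>
    layerStep_ff hp5 y1 hψ hS hπ (layerStep_att hp hN hB hS hC hπ)
  have w1 : Base p x₀ (layerFix.att p (layerStep.ff p (layerStep.att p x))) := z1.att layerFix (by
    simp only [layerFix, List.mem_cons, List.not_mem_nil, or_false]
    rintro h rfl; exact ⟨rfl, fun s => rfl⟩)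
  have w2 := fun π hπ => layerFix_att hp hN z1 hS z2 (π := π) hπ
  exact ⟨w1.ff layerFix fun a => ⟨rfl, fun s => rfl⟩, fun π hπ =>
    ff_content (fun _ _ => rfl) w1.rep (w2 π hπ)⟩

theorem iterate_spec (hp : 15 ≤ p) (hN : 2 ^ 15 * N ^ 4 ≤ 2 ^ p) (hψ : Represents x₀ ψ tok)
    (hB : Base p x₀ x)
    (hC : ∀ π ∈ ψ.nodes, HasContent (x (tok π)) (nodeContent p ψ tok (start ψ) π)) (t : ℕ) :
    Base p x₀ ((runBlock p (loopedBlock k))^[t] x) ∧ ∀ π ∈ ψ.nodes,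
      HasContent ((runBlock p (loopedBlock k))^[t] x (tok π))
        (nodeContent p ψ tok (iter ψ t) π) := by
  induction t with
  | zero => exact ⟨hB, hC⟩
  | succ t ih =>
    rw [Function.iterate_succ_apply', iter_succ]
    exact looped_spec hp hN hψ (sound_iter ψ t) ih.1 ih.2

end Run

/-- In `precision`, the factor 4 pays for the gap of order `N ^ (-4)` between directions and the
summand 15 for the rounding errors. -/
theorem pow_precision (q : ℕ → ℕ) (N : ℕ) : 2 ^ 15 * N ^ 4 ≤ 2 ^ precision q N := by
  have h := (Nat.lt_pow_succ_log_self (b := 2) (by norm_num) N).le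
  calc 2 ^ 15 * N ^ 4 ≤ 2 ^ 15 * (2 ^ (Nat.log 2 N + 1)) ^ 4 := by gcongr
    _ = 2 ^ (4 * (Nat.log 2 N + 1) + 15) := by rw [← pow_mul, ← pow_add]; congr 1; ring
    _ ≤ 2 ^ precision q N := Nat.pow_le_pow_right (by norm_num) (Nat.le_add_right _ _)

end AHAT

end

theorem mainTheorem5 (k : ℕ) (q : ℕ → ℕ) (hq : AHAT.IsOLog q) :
    ∃ (e : ℕ) (u : Fin e → ℝ) (out : Fin e)
      (T : AHAT.LoopedTransformer ((Slot ⊕ Fin k) ⊕ Fin e)),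
      AHAT.IsOLog T.loops ∧ AHAT.IsOLog T.prec ∧
      ∀ (N : ℕ) (x : Fin N → Slot ⊕ Fin k → ℝ) (ψ : BoolFormula) (tok : List Bool → Fin N),
        (∀ i c, AHAT.Representable (q N) (x i c)) → Represents x ψ tok →
        (∀ i c, T.run (allocate (T.prec N) u x) i (.inl c) = x i c) ∧
        ∀ π φ, ψ.subAt π = some φ →
          T.run (allocate (T.prec N) u x) (tok π) (.inr out) = if φ.eval then 1 else 0 := by
  refine ⟨Fintype.card AHAT.Reg, AHAT.initVec, Fintype.equivFin AHAT.Reg (.known true),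
    AHAT.evaluator k q, AHAT.isOLog_four_mul_log 1, (AHAT.isOLog_four_mul_log 15).add hq, ?_⟩
  intro N x ψ tok hx hψ
  set p := AHAT.precision q N with hpdef
  have hp : 15 ≤ p := by rw [hpdef, AHAT.precision]; omega
  -- The summand `q N` of the precision keeps the given entries exactly representable, so adding
  -- zero to them changes nothing.
  have hqp : q N ≤ p := by rw [hpdef, AHAT.precision]; omega
  have hN : 2 ^ 15 * N ^ 4 ≤ 2 ^ p := AHAT.pow_precision q N
  have hC : ∀ i, AHAT.HasContent (allocate p AHAT.initVec x i) AHAT.Content.init := by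
    intro i r
    have hr : AHAT.Representable p (AHAT.Content.init.val r) := by
      cases r with
      | one => exact AHAT.rnd_one p
      | known b => exact AHAT.representable_bit _ _
      | act => exact AHAT.representable_bit _ _
      | tmp src b => exact AHAT.representable_bit _ _
      | _ => exact AHAT.representable_blank _
    simp only [allocate, AHAT.reg, AHAT.initVec, Sum.elim_inr, Equiv.symm_apply_apply]
    exact hr
  have hrep : ∀ i c, AHAT.Representable p (allocate p AHAT.initVec x i c) := by
    rintro i (c | c)
    · exact (hx i c).mono hqp
    · exact AHAT.rnd_rnd _ _
  obtain ⟨b0, c0⟩ := AHAT.initial_spec hp hN hrep (fun i c => rfl) hC hψ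
  obtain ⟨b1, c1⟩ := AHAT.iterate_spec hp hN hψ b0 c0 (AHAT.rounds N)
  refine ⟨b1.orig, fun π φ hφ => ?_⟩
  -- The exponent is the number of doublings contained in `rounds N`.
  have hsize : ψ.size ≤ 2 ^ (Nat.log 2 N + 1) :=
    (BoolFormula.size_le_of_injOn hψ.injOn).trans
      (Nat.lt_pow_succ_log_self (b := 2) (by norm_num) N).le
  have h := c1 π (by simp [BoolFormula.nodes, hφ]) (.known true)
  refine (show _ = AHAT.bit ((BoolFormula.Contraction.iter ψ (AHAT.rounds N)).known π true) from
    h).trans ?_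
  rw [AHAT.rounds, BoolFormula.Contraction.known_iff hsize hφ]
  cases φ.eval <;> simp [AHAT.bit]
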